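/- Let $q>2$ be a prime power, let $\pi_0$ be a subplane of order $q$ of $\mathrm{PG}(2,q^3)$ (an image of $\mathrm{PG}(2,q)$ under $\mathrm{PGL}(3,q^3)$), and let $\ell$ be a line of $\mathrm{PG}(2,q^3)$ disjoint from $\pi_0$. An *extended subline* of $\pi_0$ is a line of $\mathrm{PG}(2,q^3)$ that meets $\pi_0$ in a subline of order $q$. Let $\mathcal O_2'$ be the set of points of $\mathrm{PG}(2,q^3)$ lying on exactly one extended subline of $\pi_0$, and let $\mathcal O_3'$ be the complement of $\pi_0\cup\mathcal O_2'$. The *splash* $\mathcal S$ of $\pi_0$ on $\ell$ is the set of points of $\ell$ lying on some extended subline of $\pi_0$. Let $s\subset\mathcal S$ be a subline of order $q$ of $\ell$ that arises from a dual subconic of $\pi_0$; that is, $s$ is the set of points in which $\ell$ meets the lines of $\mathcal D$, where $\mathcal D$ is the set of the $q+1$ extended sublines of $\pi_0$ whose line coordinates over $\mathrm{GF}(q)$ (in a frame of $\pi_0$) satisfy the equation of a non-degenerate conic over $\mathrm{GF}(q)$. Let $\mathcal E$ be the set of lines of $\mathrm{PG}(2,q^3)$ not in $\mathcal D$ that have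 at least one point in common with $s$ and at least one point in common with $\pi_0$. Then through every point of $\mathrm{PG}(2,q^3)$ not lying in $\pi_0\cup s$ there pass $0$, $1$, $2$, $3$ or $q+1$ lines of $\mathcal E$. Moreover, there are exactly $q^2$ points not in $\pi_0\cup s$ through which there pass $q+1$ lines of $\mathcal E$, and all of them lie in $\mathcal O_3'$. -/

import Mathlib

open scoped LinearAlgebra.Projectivization

namespace SplashPlane

/-- The points of the projective plane `PG(2, K)`. -/
abbrev Point (K : Type*) [Field K] : Type _ := ℙ K (Fin 3 → K)

/-- A point `P` lies on the projective subspace given by the vector subspace `m`. -/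
def OnLine {K : Type*} [Field K] (P : Point K) (m : Submodule K (Fin 3 → K)) : Prop :=
  P.submodule ≤ m

/-- The lines of `PG(2, K)`: the two-dimensional vector subspaces of `K³`. -/
def IsLine {K : Type*} [Field K] (m : Submodule K (Fin 3 → K)) : Prop :=
  Module.finrank K m = 2

/-- The points of `PG(2, K)` that have a representative vector which is an `F`-linear
combination of the vectors `b i`. -/
def subgeometry (F : Type*) {K : Type*} [Field F] [Field K] [Algebra F K] {ι : Type*}
    (b : ι → Fin 3 → K) : Set (Point K) :=
  {P | ∃ (w : Fin 3 → K) (hw : w ≠ 0),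
    w ∈ Submodule.span F (Set.range b) ∧ Projectivization.mk K w hw = P}

/-- A subplane of order `|F|` of `PG(2, K)`: an image of the canonical subplane `PG(2, F)`
under a projectivity. -/
def IsSubplane (F : Type*) {K : Type*} [Field F] [Field K] [Algebra F K]
    (π₀ : Set (Point K)) : Prop :=
  ∃ b : Module.Basis (Fin 3) K (Fin 3 → K), π₀ = subgeometry F b

/-- A subline of order `|F|` of the line `m` of `PG(2, K)`. -/
def IsSubline (F : Type*) {K : Type*} [Field F] [Field K] [Algebra F K]
    (m : Submodule K (Fin 3 → K)) (s : Set (Point K)) : Prop :=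
  ∃ b : Fin 2 → Fin 3 → K, LinearIndependent K b ∧
    Submodule.span K (Set.range b) = m ∧ s = subgeometry F b

/-- The extended sublines of `π₀`: the lines of `PG(2, K)` that meet `π₀` in a subline of
order `|F|`. -/
def extendedSublines (F : Type*) {K : Type*} [Field F] [Field K] [Algebra F K]
    (π₀ : Set (Point K)) : Set (Submodule K (Fin 3 → K)) :=
  {m | IsLine m ∧ IsSubline F m {P | P ∈ π₀ ∧ OnLine P m}}

/-- The points lying on exactly one extended subline of `π₀`. -/
def O₂ (F : Type*) {K : Type*} [Field F] [Field K] [Algebra F K]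
    (π₀ : Set (Point K)) : Set (Point K) :=
  {P | ∃! m, m ∈ extendedSublines F π₀ ∧ OnLine P m}

/-- The points that are neither in `π₀` nor on exactly one extended subline of `π₀`. -/
def O₃ (F : Type*) {K : Type*} [Field F] [Field K] [Algebra F K]
    (π₀ : Set (Point K)) : Set (Point K) :=
  (π₀ ∪ O₂ F π₀)ᶜ

/-- The splash of `π₀` on `l`: the points of `l` lying on some extended subline of `π₀`. -/
def splash (F : Type*) {K : Type*} [Field F] [Field K] [Algebra F K]
    (π₀ : Set (Point K)) (l : Submodule K (Fin 3 → K)) : Set (Point K) :=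
  {P | OnLine P l ∧ ∃ m ∈ extendedSublines F π₀, OnLine P m}

/-- The line with equation `u 0 * x 0 + u 1 * x 1 + u 2 * x 2 = 0`, where `x i` are the
coordinates with respect to the basis `b` and the coefficients `u i` lie in `F`. -/
noncomputable def dualLine {F K : Type*} [Field F] [Field K] [Algebra F K]
    (b : Module.Basis (Fin 3) K (Fin 3 → K)) (u : Fin 3 → F) : Submodule K (Fin 3 → K) :=
  LinearMap.ker (∑ i, algebraMap F K (u i) • b.coord i)

/-- `D` is the set of extended sublines of a dual subconic of `π₀`: in homogeneous coordinates
over `F` adapted to `π₀`, it consists of the lines whose line coordinates satisfy the equation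
of a non-degenerate conic defined over `F`. -/
def IsDualSubconic (F : Type*) {K : Type*} [Field F] [Field K] [Algebra F K]
    (π₀ : Set (Point K)) (D : Set (Submodule K (Fin 3 → K))) : Prop :=
  ∃ (b : Module.Basis (Fin 3) K (Fin 3 → K)) (Q : QuadraticForm F (Fin 3 → F)),
    π₀ = subgeometry F b ∧ Q.Nondegenerate ∧
      D = {m | ∃ u : Fin 3 → F, u ≠ 0 ∧ Q u = 0 ∧ m = dualLine b u}

/-- The set of points in which the lines of `D` meet the line `l`. -/
def trace {K : Type*} [Field K] (D : Set (Submodule K (Fin 3 → K)))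
    (l : Submodule K (Fin 3 → K)) : Set (Point K) :=
  {P | OnLine P l ∧ ∃ m ∈ D, OnLine P m}

/-- The lines, other than those of `D`, having at least a point in common with both
`s` and `π₀`. -/
def linesE {K : Type*} [Field K] (π₀ s : Set (Point K))
    (D : Set (Submodule K (Fin 3 → K))) : Set (Submodule K (Fin 3 → K)) :=
  {m | IsLine m ∧ (∃ P ∈ s, OnLine P m) ∧ (∃ P ∈ π₀, OnLine P m) ∧ m ∉ D}

/-- The number of lines of `E` through the point `P`. -/
noncomputable def numThrough {K : Type*} [Field K] (E : Set (Submodule K (Fin 3 → K)))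
    (P : Point K) : ℕ :=
  {m | m ∈ E ∧ OnLine P m}.ncard

end SplashPlane

/-! Write tr and N for the trace and norm of K/F. Since `l` misses `π₀`, an equation of `l` and its
two conjugates serve as coordinates: `π₀` becomes {(x, σx, σ²x)}, `l` becomes X = 0, and each
extended subline has coefficients (a, σa, σ²a), so it meets `l` in (0, σw, -σ²w) with w = 1/a
(`exists_isSplashFrame`).

Comparing norms shows that a subline inside the splash comes either from an F-plane of values w or
from an F-plane of values a. In the second case the lines form a pencil, which a non-degenerate dual
conic cannot contain. So `s` is given by tr(cw) = 0, and a diagonal change of frame makes c = 1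
(`exists_normalized_frame`).

The join of (1, Y, Z) to the point w of `s` meets `π₀` exactly when an F-linear equation in x, σx,
σ²x has a nonzero solution. This forces the determinant of the equation and its conjugates to
vanish. Because tr w = 0, that determinant is w³ times a cubic in σw/w, and this ratio determines
the point of `s`. Hence at most three lines of `E` pass through the point unless the cubic vanishes
identically.

By `of_joinCubic_eq_zero`, identical vanishing leaves only the points of `π₀` and the points
`exceptionalVec σ k` with tr k = 1. Through the latter every join to `s` meets `π₀`, while no
extended subline passes at all: no join is lost to `D`, there are q + 1 of them, and the point lies
in `O₃`. Distinct k give distinct points, and q² elements of K have trace 1. -/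

open scoped LinearAlgebra.Projectivization

namespace SplashPlane

/-! ### Cyclic cubic extensions -/

variable {F K : Type*} [Field F] [Field K] [Algebra F K]

/-- `σ` generates the Galois group of the cubic extension `K / F`. -/
structure IsCubicFrobenius (σ : K →ₐ[F] K) : Prop where
  cube : ∀ x, σ (σ (σ x)) = x
  trace_eq : ∀ x, algebraMap F K (Algebra.trace F K x) = x + σ x + σ (σ x)
  trace_surjective : Function.Surjective (Algebra.trace F K)
  finrank_eq : Module.finrank F K = 3

theorem exists_isCubicFrobenius [Finite F] [Finite K]
    (h : Nat.card K = Nat.card F ^ 3) : ∃ σ : K →ₐ[F] K, IsCubicFrobenius σ := by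
  have := Fintype.ofFinite F
  have hr : Module.finrank F K = 3 := by
    rw [Module.natCard_eq_pow_finrank (K := F)] at h
    exact Nat.pow_right_injective (Finite.one_lt_card (α := F)) h
  refine ⟨FiniteField.frobeniusAlgHom F K, fun x ↦ ?_, fun x ↦ ?_,
    Algebra.trace_surjective F K, hr⟩
  · have := orderOf_dvd_iff_pow_eq_one.mp
      (FiniteField.orderOf_frobeniusAlgHom F K ▸ hr ▸ dvd_rfl :
        orderOf (FiniteField.frobeniusAlgHom F K) ∣ 3)
    simpa [pow_succ] using DFunLike.congr_fun this x
  · rw [FiniteField.algebraMap_trace_eq_sum_pow, hr]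
    simp [Finset.sum_range_succ, ← pow_mul, pow_two]

namespace IsCubicFrobenius

variable {σ : K →ₐ[F] K} (hσ : IsCubicFrobenius σ)
include hσ

theorem exists_algebraMap_eq {x : K} (hx : σ x = x) : ∃ c : F, algebraMap F K c = x := by
  obtain ⟨y, hy⟩ := hσ.trace_surjective 1
  -- A fixed x factors out: tr(xy) = x tr(y) = x. Using tr(x)/3 instead would fail in characteristic
  -- 3.
  refine ⟨Algebra.trace F K (x * y), ?_⟩
  have h := hσ.trace_eq y
  rw [hy, map_one] at h
  rw [hσ.trace_eq, map_mul, map_mul, hx, hx]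
  linear_combination -x * h

theorem exists_algebraMap_mul_eq {x y : K} (hx : x ≠ 0) (h : σ y * x = y * σ x) :
    ∃ c : F, y = algebraMap F K c * x := by
  have hx' : σ x ≠ 0 := (map_ne_zero σ).mpr hx
  obtain ⟨c, hc⟩ := hσ.exists_algebraMap_eq (x := y / x) (by
    rw [map_div₀, div_eq_div_iff hx' hx, h])
  exact ⟨c, by rw [hc, div_mul_cancel₀ _ hx]⟩

theorem eq_zero_of_trace_mul_eq_zero {a : K}
    (h : ∀ x, Algebra.trace F K (a * x) = 0) : a = 0 := by
  by_contra ha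
  obtain ⟨y, hy⟩ := hσ.trace_surjective 1
  have := h (a⁻¹ * y)
  rw [mul_inv_cancel_left₀ ha, hy] at this
  exact one_ne_zero this

theorem finrank_ker_trace : Module.finrank F (LinearMap.ker (Algebra.trace F K)) = 2 := by
  have : FiniteDimensional F K := FiniteDimensional.of_finrank_pos (by rw [hσ.finrank_eq]; simp)
  have h := LinearMap.finrank_range_add_finrank_ker (Algebra.trace F K)
  rw [LinearMap.range_eq_top.mpr hσ.trace_surjective, finrank_top, hσ.finrank_eq,
    Module.finrank_self] at h
  omega

theorem trace_eq_zero_iff {x : K} : Algebra.trace F K x = 0 ↔ x + σ x + σ (σ x) = 0 := by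
  rw [← hσ.trace_eq, map_eq_zero_iff _ (algebraMap F K).injective]

theorem trace_eq_one_iff {x : K} : Algebra.trace F K x = 1 ↔ x + σ x + σ (σ x) = 1 := by
  rw [← hσ.trace_eq, ← (algebraMap F K).injective.eq_iff, map_one]

theorem exists_trace_eq_zero : ∃ x : K, x ≠ 0 ∧ Algebra.trace F K x = 0 := by
  have : FiniteDimensional F K := FiniteDimensional.of_finrank_pos (by rw [hσ.finrank_eq]; simp)
  have : Nontrivial (LinearMap.ker (Algebra.trace F K)) :=
    Module.nontrivial_of_finrank_pos (R := F) (by rw [hσ.finrank_ker_trace]; simp)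
  obtain ⟨x, hx⟩ := exists_ne (0 : LinearMap.ker (Algebra.trace F K))
  exact ⟨x, by simpa using hx, x.2⟩

theorem exists_ne : ∃ x : K, σ x ≠ x := by
  by_contra! h
  have hs : Function.Surjective (Algebra.linearMap F K) := fun x ↦ hσ.exists_algebraMap_eq (h x)
  have := LinearMap.finrank_le_finrank_of_surjective hs
  rw [hσ.finrank_eq, Module.finrank_self] at this
  omega

/-- Hilbert's theorem 90 for a cubic cyclic extension. -/
theorem exists_eq_mul_of_norm_eq_one {y : K} (hy : y * σ y * σ (σ y) = 1) :
    ∃ x : K, x ≠ 0 ∧ σ x = y * x := by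
  have h0 : y ≠ 0 := fun h ↦ by simp [h] at hy
  -- Lagrange resolvent: `hy` makes σ multiply it by y. That it is not identically zero is
  -- independence of characters, checked below by combining the values at tm, t, m and 1.
  suffices h : ∃ t, t + σ t * (σ y * σ (σ y)) + σ (σ t) * σ (σ y) ≠ 0 by
    obtain ⟨t, ht⟩ := h
    refine ⟨_, ht, ?_⟩
    simp only [map_add, map_mul, hσ.cube]
    linear_combination (-σ t) * hy
  by_contra! h
  obtain ⟨m, hm⟩ := hσ.exists_ne
  have h2 : ∀ t, t * (m - σ m) = σ (σ t) * (m - σ m) := by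
    intro t
    have h1 := h (t * m)
    have h2 := h t
    have h3 := h m
    have h4 := h 1
    simp only [map_mul, map_one] at h1 h4
    linear_combination h1 - σ m * h2 - σ (σ t) * h3 + σ (σ t) * σ m * h4
  have h3 := mul_right_cancel₀ (sub_ne_zero.mpr (Ne.symm hm)) (h2 (σ m))
  rw [hσ.cube] at h3
  exact hm h3

end IsCubicFrobenius

/-! ### The cubic of joins and its identical vanishing -/

/-- The algebraic core of `of_joinCubic_eq_zero`, with tᵢ the conjugates of t and gᵢ those of tY.
Expanding the conclusion reduces it to (g0 + g1 - g2)(t0 - g2) = 2N. In characteristic 2 both sides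
vanish, since then g0 + g1 + g2 = 0. Otherwise (g0 + g1 - g2)² t0 = 4N, so g0 + g1 - g2 is nonzero
and can be cancelled. -/
theorem sq_eq_mul_sum_of_cyclic {t0 t1 t2 g0 g1 g2 N : K} (hN : N = t0 * t1 * t2) (h0 : N ≠ 0)
    (h12 : t1 * t2 = N + g0 * g1) (h20 : t2 * t0 = N + g1 * g2) (h01 : t0 * t1 = N + g2 * g0)
    (h : 2 * N - 2 * (g0 * g1 * g2) = N * (g0 + g1 + g2)) :
    t0 * ((t0 - g2) + (t1 - g0) + (t2 - g1)) = (t0 - g2) ^ 2 := by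
  suffices hs : (g0 + g1 - g2) * (t0 - g2) = 2 * N by
    linear_combination -hs + h01 + h20
  obtain ⟨t, ht⟩ : ∃ t, t = g0 + g1 + g2 := ⟨_, rfl⟩
  by_cases h2 : (2 : K) = 0
  · have : g0 + g1 + g2 = 0 := by
      have := mul_eq_zero.mp (show N * (g0 + g1 + g2) = 0 by
        linear_combination -h + (N - g0 * g1 * g2) * h2)
      tauto
    linear_combination (t0 - g2) * this - (g2 * (t0 - g2) + N) * h2
  · have hg : g0 * g1 * g2 * 2 = N * (2 - t) := by rw [ht]; linear_combination -h
    have hN2 : N * 4 = t ^ 2 - 4 * (g0 * g1 + g1 * g2 + g2 * g0) := by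
      -- The product of the three relations, whose left sides multiply to N². Eliminating g0 g1 g2
      -- by `hg` leaves N² times the claim.
      have e : N * N = (N + g0 * g1) * (N + g1 * g2) * (N + g2 * g0) := by
        rw [← h12, ← h20, ← h01]
        linear_combination (N + t0 * t1 * t2) * hN
      have e2 : N * N * (N * 4 - (t ^ 2 - 4 * (g0 * g1 + g1 * g2 + g2 * g0))) = 0 := by
        rw [ht] at hg ⊢
        linear_combination -4 * e - (2 * g0 * g1 * g2 + N * (2 - (g0 + g1 + g2))
          + 2 * N * (g0 + g1 + g2)) * hg
      have := mul_eq_zero.mp e2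
      have h3 := mul_ne_zero h0 h0
      have : N * 4 - (t ^ 2 - 4 * (g0 * g1 + g1 * g2 + g2 * g0)) = 0 := by tauto
      linear_combination this
    have hd : (t - 2 * g2) ^ 2 * t0 = 4 * N := by
      have e : (N + g0 * g1) * t0 = N := by rw [← h12]; linear_combination -hN
      rw [ht] at hN2 ⊢
      linear_combination 4 * e - t0 * hN2
    have hd0 : t - 2 * g2 ≠ 0 := by
      intro h4
      rw [h4] at hd
      have h44 : (4 : K) * N ≠ 0 := mul_ne_zero (by
        rw [show (4 : K) = 2 * 2 by norm_num]; exact mul_ne_zero h2 h2) h0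
      exact h44 (by rw [← hd]; ring)
    have key : (t - 2 * g2) ^ 2 * (t0 - g2) = 2 * N * (t - 2 * g2) := by
      rw [ht] at hd hg hN2 ⊢
      linear_combination hd - g2 * (-hN2) - 2 * hg
    have := mul_right_cancel₀ hd0
      (show (t - 2 * g2) * (t0 - g2) * (t - 2 * g2) = 2 * N * (t - 2 * g2) by
        rw [← key]; ring)
    rw [← this, ht]; ring

/-- The cubic polynomial whose roots `σ w / w` belong to the lines that join the point
`(1, Y, Z)` to the point `(0, σ w, -σ² w)`, `tr w = 0`, and meet the subplane
`{(x, σ x, σ² x)}`. -/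
noncomputable def joinCubic (σ : K →ₐ[F] K) (Y Z : K) : Polynomial K :=
  .C (σ (σ Z) - Y - Y * σ (σ Z) * (σ Z - σ Y)) +
  .C (-2 - (Y - Z) + 2 * σ (σ Z) + σ (σ Y) - (Y - Z) * (σ Z - σ Y) * σ (σ Z)
    - Y * σ Z * σ (σ Z) - Y * (σ Z - σ Y) * σ (σ Y)) * .X +
  .C (-2 - (σ Z - σ Y) + σ (σ Z) + 2 * σ (σ Y) - (Y - Z) * σ Z * σ (σ Z)
    - (Y - Z) * (σ Z - σ Y) * σ (σ Y) - Y * σ Z * σ (σ Y)) * .X ^ 2 +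
  .C (σ (σ Y) - σ Z - (Y - Z) * σ Z * σ (σ Y)) * .X ^ 3

theorem natDegree_joinCubic_le (σ : K →ₐ[F] K) (Y Z : K) : (joinCubic σ Y Z).natDegree ≤ 3 := by
  unfold joinCubic
  compute_degree

namespace IsCubicFrobenius

variable {σ : K →ₐ[F] K} (hσ : IsCubicFrobenius σ)
include hσ

/-- The hypothesis and its two conjugates form a homogeneous linear system in (x, σx, σ²x) with a
nonzero solution, so its determinant vanishes. The multipliers in the final `linear_combination` are
the cofactors of the first column. -/
theorem isRoot_joinCubic {Y Z w x : K} (hw : w ≠ 0) (htw : w + σ w + σ (σ w) = 0) (hx : x ≠ 0)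
    (h : -(σ (σ w) * Y + σ w * Z) * x + σ (σ w) * σ x + σ w * σ (σ x) = 0) :
    (joinCubic σ Y Z).IsRoot (σ w / w) := by
  have h1 := congrArg σ h
  have h2 := congrArg σ h1
  simp only [map_add, map_mul, map_neg, hσ.cube, map_zero] at h1 h2
  have hd : (joinCubic σ Y Z).eval (σ w / w) * w ^ 3 * x = 0 := by
    simp only [joinCubic, Polynomial.eval_add, Polynomial.eval_mul, Polynomial.eval_C,
      Polynomial.eval_X, Polynomial.eval_pow]
    have hw2 : σ (σ w) = -w - σ w := by linear_combination htw
    rw [hw2] at h h1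
    generalize σ w = v at *
    generalize σ (σ x) = x2 at *
    generalize σ x = x1 at *
    generalize σ (σ Y) = Y2 at *
    generalize σ (σ Z) = Z2 at *
    generalize σ Y = Y1 at *
    generalize σ Z = Z1 at *
    field_simp
    linear_combination ((-(w * Y1 + (-w - v) * Z1)) * (-(v * Y2 + w * Z2)) - w ^ 2) * h
      + (w * v - (-w - v) * (-(v * Y2 + w * Z2))) * h1
      + ((-w - v) * w - v * (-(w * Y1 + (-w - v) * Z1))) * h2
  simpa [hw, hx] using hd

/-- The coefficients of X and X³ suffice. The dividing line is t = 1 - σY σ²Z: if t = 0, Hilbert 90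
puts (1, Y, Z) in the subplane; if t ≠ 0, then `sq_eq_mul_sum_of_cyclic` produces k. -/
theorem of_joinCubic_eq_zero {Y Z : K} (h : joinCubic σ Y Z = 0) :
    (∃ x, x ≠ 0 ∧ σ x = Y * x ∧ σ (σ x) = Z * x) ∨
    ∃ k, k ≠ 0 ∧ k + σ k + σ (σ k) = 1 ∧ Y * k ^ 2 = -(σ k * (k + σ (σ k))) ∧
      Z * k ^ 2 = -(σ (σ k) * (k + σ k)) := by
  have c1 := congrArg (Polynomial.coeff · 1) h
  have c3 := congrArg (Polynomial.coeff · 3) h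
  simp only [joinCubic, Polynomial.coeff_add, Polynomial.coeff_C_mul, Polynomial.coeff_X_pow,
    Polynomial.coeff_C, Polynomial.coeff_X, Polynomial.coeff_zero] at c1 c3
  norm_num at c1 c3
  -- `c0` and `c2` are the conjugates of the leading coefficient, which give `e0`, `e1`, `e2`.
  have c0 := congrArg σ c3
  have c2 := congrArg σ c0
  simp only [map_mul, map_sub, hσ.cube, map_zero] at c0 c2
  obtain ⟨t, ht⟩ : ∃ t, t = 1 - σ Y * σ (σ Z) := ⟨_, rfl⟩
  have ht1 : σ t = 1 - σ (σ Y) * Z := by simp [ht, hσ.cube]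
  have ht2 : σ (σ t) = 1 - Y * σ Z := by simp [ht1, hσ.cube]
  have e0 : t * Y = σ (σ t) * σ (σ Z) := by rw [ht2, ht]; linear_combination c0
  have e1 : σ t * σ Y = t * Z := by rw [ht1, ht]; linear_combination c2
  have e2 : σ (σ t) * σ (σ Y) = σ t * σ Z := by rw [ht2, ht1]; linear_combination c3
  have E : 2 - Y * σ Y * σ (σ Y) - Z * σ Z * σ (σ Z) = t * Y + σ t * σ Y + σ (σ t) * σ (σ Y) := by
    rw [ht2, ht1, ht] at *
    linear_combination -c1 - 2 * e0 - e1
  by_cases h0 : t = 0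
  · left
    have hYZ : σ Y * σ (σ Z) = 1 := by rw [h0] at ht; linear_combination ht
    have hYZ1 : σ (σ Y) * Z = 1 := by simpa [hσ.cube] using congrArg σ hYZ
    have hYZ2 : Y * σ Z = 1 := by simpa [hσ.cube] using congrArg σ hYZ1
    simp only [h0, map_zero, zero_mul, add_zero] at E
    have hn : Y * σ Y * σ (σ Y) = 1 := by
      -- N(Y) and N(Z) have sum 2 and product 1.
      have : (Y * σ Y * σ (σ Y) - 1) ^ 2 = 0 := by
        linear_combination -(Y * σ Y * σ (σ Y)) * E + -(Y * σ Z * σ (σ Y) * Z) * hYZ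
          - (Y * σ Z) * hYZ1 - hYZ2
      simpa [sub_eq_zero] using this
    obtain ⟨x, hx, hx1⟩ := hσ.exists_eq_mul_of_norm_eq_one hn
    refine ⟨x, hx, hx1, ?_⟩
    rw [hx1, map_mul, hx1]
    have : σ Y * Y = Z := by
      linear_combination Z * hn - σ Y * Y * hYZ1
    linear_combination x * this
  · right
    have h1 : σ t ≠ 0 := (map_ne_zero σ).mpr h0
    have h2 : σ (σ t) ≠ 0 := (map_ne_zero σ).mpr h1
    obtain ⟨N, hN⟩ : ∃ N, N = t * σ t * σ (σ t) := ⟨_, rfl⟩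
    have hN0 : N ≠ 0 := by rw [hN]; positivity
    have h12 : σ t * σ (σ t) = N + (t * Y) * (σ t * σ Y) := by
      rw [e0]
      linear_combination -hN - σ t * σ (σ t) * ht
    have h20 : σ (σ t) * t = N + (σ t * σ Y) * (σ (σ t) * σ (σ Y)) := by
      rw [e1]
      linear_combination -hN - σ (σ t) * t * ht1
    have h01 : t * σ t = N + (σ (σ t) * σ (σ Y)) * (t * Y) := by
      rw [e2]
      linear_combination -hN - t * σ t * ht2
    have hZ : Y * σ Y * σ (σ Y) * N = Z * σ Z * σ (σ Z) * N := by
      have : (t * Y) * (σ t * σ Y) * (σ (σ t) * σ (σ Y)) =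
        (σ (σ t) * σ (σ Z)) * (t * Z) * (σ t * σ Z) := by rw [e0, e1, e2]
      rw [hN]
      linear_combination this
    have key := sq_eq_mul_sum_of_cyclic hN hN0 h12 h20 h01 (by
      rw [← E]
      linear_combination -hZ + 2 * Y * σ Y * σ (σ Y) * hN)
    -- With T = tr j the key identity reads tT = j², while tY = σt - σj. Eliminating t expresses Y
    -- through j alone, likewise Z; dividing j by T normalizes the trace to 1.
    obtain ⟨j, hj⟩ : ∃ j, j = t - σ (σ t) * σ (σ Y) := ⟨_, rfl⟩
    have hj1 : σ j = σ t - t * Y := by simp [hj, hσ.cube]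
    have hj2 : σ (σ j) = σ (σ t) - σ t * σ Y := by simp [hj1]
    rw [← hj, ← hj1, ← hj2] at key
    obtain ⟨T, hT⟩ : ∃ T, T = j + σ j + σ (σ j) := ⟨_, rfl⟩
    have hTσ : σ T = T := by rw [hT]; simp only [map_add, hσ.cube]; ring
    rw [← hT] at key
    have key1 : σ t * T = σ j ^ 2 := by simpa [hTσ] using congrArg σ key
    have key2 : σ (σ t) * T = σ (σ j) ^ 2 := by simpa [hTσ] using congrArg σ key1
    have hj0 : j ≠ 0 := by
      intro hj0
      rw [hj0, map_zero] at hj1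
      rw [hj0] at hj
      exact hN0 (by linear_combination -h01 - t * hj1 - (t * Y) * hj)
    have hT0 : T ≠ 0 := by
      rintro rfl
      rw [mul_zero] at key
      exact hj0 (pow_eq_zero_iff two_ne_zero |>.mp key.symm)
    refine ⟨j / T, div_ne_zero hj0 hT0, ?_, ?_, ?_⟩
    · simp only [map_div₀, hTσ]
      field_simp
      exact hT.symm
    · simp only [map_div₀, hTσ]
      field_simp
      rw [← key]
      linear_combination T * hj1 + key1 - σ j * hT
    · simp only [map_div₀, hTσ]
      field_simp
      rw [← key]
      linear_combination T * hj2 + key2 - T * e1 - σ (σ j) * hT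

end IsCubicFrobenius

/-! ### Coordinates adapted to the subplane and the line -/

/-- The coordinates of the points of the subplane in a splash frame. -/
def conjVec (σ : K →ₐ[F] K) (x : K) : Fin 3 → K := ![x, σ x, σ (σ x)]

/-- The linear form whose coefficients are the conjugates of `a`. -/
def conjForm (σ : K →ₐ[F] K) (a : K) (v : Fin 3 → K) : K := a * v 0 + σ a * v 1 + σ (σ a) * v 2

/-- The coordinates of a point of the splash in a splash frame. -/
def splashVec (σ : K →ₐ[F] K) (w : K) : Fin 3 → K := ![0, σ w, -σ (σ w)]

/-- Coordinates in which the subplane `π₀` is `{(x, σ x, σ² x)}` and the line `l` has equation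
`X = 0`. -/
structure IsSplashFrame (σ : K →ₐ[F] K) (π₀ : Set (Point K)) (l : Submodule K (Fin 3 → K))
    (Φ : (Fin 3 → K) ≃ₗ[K] (Fin 3 → K)) : Prop where
  mem_subplane : ∀ v (hv : v ≠ 0), Projectivization.mk K v hv ∈ π₀ ↔
    ∃ c x : K, Φ v = c • conjVec σ x
  mem_line : ∀ v, v ∈ l ↔ Φ v 0 = 0

theorem onLine_mk {v : Fin 3 → K} (hv : v ≠ 0) (m : Submodule K (Fin 3 → K)) :
    OnLine (Projectivization.mk K v hv) m ↔ v ∈ m := by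
  rw [OnLine, Projectivization.submodule_mk, Submodule.span_singleton_le_iff_mem]

theorem exists_ker_eq_of_isLine {l : Submodule K (Fin 3 → K)} (hl : IsLine l) :
    ∃ f : (Fin 3 → K) →ₗ[K] K, LinearMap.ker f = l := by
  have h := l.finrank_quotient_add_finrank
  rw [hl, Module.finrank_fin_fun] at h
  have e : ((Fin 3 → K) ⧸ l) ≃ₗ[K] K := LinearEquiv.ofFinrankEq _ _ (by
    rw [Module.finrank_self]; omega)
  exact ⟨e.toLinearMap ∘ₗ l.mkQ, by rw [LinearEquiv.ker_comp, Submodule.ker_mkQ]⟩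

/-- An equation f of `l` is injective on F-rational vectors because `l` misses the subplane, so it
identifies F³ with K by dimension. The new coordinates are f and its conjugates. A line with
coefficients (a, σa, σ²a) then has rational coordinates tr(a uᵢ), with uᵢ the coefficients of f. -/
theorem IsCubicFrobenius.exists_isSplashFrame {σ : K →ₐ[F] K} (hσ : IsCubicFrobenius σ)
    (b : Module.Basis (Fin 3) K (Fin 3 → K)) {l : Submodule K (Fin 3 → K)} (hl : IsLine l)
    (hdisj : ∀ P ∈ subgeometry F b, ¬ OnLine P l) :
    ∃ (Φ : (Fin 3 → K) ≃ₗ[K] (Fin 3 → K)) (ψ : K ≃ₗ[F] (Fin 3 → F)),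
      IsSplashFrame σ (subgeometry F b) l Φ ∧
      ∀ a v, v ∈ dualLine b (ψ a) ↔ conjForm σ a (Φ v) = 0 := by
  have hfd : FiniteDimensional F K := FiniteDimensional.of_finrank_pos (by
    rw [hσ.finrank_eq]; simp)
  obtain ⟨f, hf⟩ := exists_ker_eq_of_isLine hl
  let u : Fin 3 → K := fun i ↦ f (b i)
  have hfu : ∀ v, f v = ∑ i, b.repr v i * u i := fun v ↦ by
    conv_lhs => rw [← b.sum_repr v]
    simp only [map_sum, map_smul, smul_eq_mul, u]
  -- rational coordinates
  let φ : (Fin 3 → F) →ₗ[F] K := Fintype.linearCombination F u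
  have hφ : ∀ x, φ x = ∑ i, algebraMap F K (x i) * u i := fun x ↦ by
    simp [φ, Fintype.linearCombination_apply, Algebra.smul_def]
  have hrepr : ∀ x : Fin 3 → F, ∀ i, b.repr (∑ i, x i • b i) i = algebraMap F K (x i) := by
    intro x i
    have : ∑ i, x i • b i = ∑ i, algebraMap F K (x i) • b i := by simp
    rw [this, b.repr_sum_self]
  have hφinj : Function.Injective φ := by
    rw [injective_iff_map_eq_zero]
    intro x hx
    by_contra hx0
    have hw : ∑ i, x i • b i ≠ 0 := by
      intro h0
      apply hx0
      ext i
      have := hrepr x i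
      rw [h0] at this
      simpa using this.symm
    refine hdisj (Projectivization.mk K _ hw) ⟨_, hw, ?_, rfl⟩ ?_
    · exact Submodule.sum_mem _ fun i _ ↦ Submodule.smul_mem _ _
        (Submodule.subset_span ⟨i, rfl⟩)
    · rw [onLine_mk, ← hf, LinearMap.mem_ker, hfu]
      simp_rw [hrepr]
      rw [← hφ, hx]
  let φe : (Fin 3 → F) ≃ₗ[F] K := LinearEquiv.ofInjectiveOfFinrankEq φ hφinj (by
    rw [hσ.finrank_eq, Module.finrank_fin_fun])
  have hφe : ∀ x, φe x = φ x := fun x ↦ rfl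
  -- the coordinate change
  let T : (Fin 3 → K) →ₗ[K] (Fin 3 → K) :=
    LinearMap.pi ![∑ i, u i • b.coord i, ∑ i, σ (u i) • b.coord i, ∑ i, σ (σ (u i)) • b.coord i]
  have hT0 : ∀ v, T v 0 = ∑ i, b.repr v i * u i := fun v ↦ by simp [T, mul_comm]
  have hT1 : ∀ v, T v 1 = ∑ i, b.repr v i * σ (u i) := fun v ↦ by simp [T, mul_comm]
  have hT2 : ∀ v, T v 2 = ∑ i, b.repr v i * σ (σ (u i)) := fun v ↦ by simp [T, mul_comm]
  have hTinj : Function.Injective T := by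
    rw [injective_iff_map_eq_zero]
    intro v hv
    have h0 := hT0 v
    have h1 := hT1 v
    have h2 := hT2 v
    rw [hv, Pi.zero_apply] at h0 h1 h2
    have key : ∀ i, b.repr v i = 0 := by
      intro i
      apply hσ.eq_zero_of_trace_mul_eq_zero
      intro t
      -- If all three conjugate forms vanish at v, then Σ tr(vᵢ t) uᵢ = 0 for every t. Independence
      -- of the uᵢ over F and non-degeneracy of the trace form give v = 0.
      have : φ (fun i ↦ Algebra.trace F K (b.repr v i * t)) = 0 := by
        have h1' := congrArg (fun x ↦ σ (σ x)) h1
        have h2' := congrArg σ h2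
        simp only [Fin.sum_univ_three, map_add, map_mul, map_zero, hσ.cube] at h0 h1' h2'
        simp only [hφ, hσ.trace_eq, Fin.sum_univ_three, map_mul]
        linear_combination -t * h0 - σ (σ t) * h1' - σ t * h2'
      exact congrFun (hφinj (this.trans (map_zero φ).symm)) i
    rw [← b.sum_repr v]
    simp [key]
  let Φ : (Fin 3 → K) ≃ₗ[K] (Fin 3 → K) := LinearEquiv.ofInjectiveEndo T hTinj
  have hΦ : ∀ v, Φ v = T v := fun v ↦ rfl
  have hrat : ∀ x : Fin 3 → F, Φ (∑ i, x i • b i) = conjVec σ (φ x) := by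
    intro x
    rw [hΦ]
    ext j
    fin_cases j
    · simp only [Fin.zero_eta, hT0, hrepr, ← hφ]; rfl
    · simp only [Fin.mk_one, hT1, hrepr]
      simp only [hφ, conjVec, Matrix.cons_val_one, Matrix.cons_val_zero,
        map_sum, map_mul, AlgHom.commutes]
    · simp only [Fin.reduceFinMk, hT2, hrepr]
      simp only [hφ, conjVec, Matrix.cons_val,
        map_sum, map_mul, AlgHom.commutes]
  -- line coordinates
  let p : K →ₗ[F] (Fin 3 → F) :=
    LinearMap.pi fun i ↦ (Algebra.trace F K).comp (LinearMap.mulRight F (u i))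
  have hp : ∀ a i, p a i = Algebra.trace F K (a * u i) := fun a i ↦ rfl
  have hpinj : Function.Injective p := by
    rw [injective_iff_map_eq_zero]
    intro a ha
    apply hσ.eq_zero_of_trace_mul_eq_zero
    intro x
    obtain ⟨y, rfl⟩ := φe.surjective x
    have : a * φe y = ∑ i, y i • (a * u i) := by
      rw [hφe, hφ, Finset.mul_sum]
      exact Finset.sum_congr rfl fun i _ ↦ by rw [Algebra.smul_def]; ring
    rw [this, map_sum]
    refine Finset.sum_eq_zero fun i _ ↦ ?_
    rw [map_smul, ← hp, ha, Pi.zero_apply, smul_zero]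
  refine ⟨Φ, LinearEquiv.ofInjectiveOfFinrankEq p hpinj (by
    rw [hσ.finrank_eq, Module.finrank_fin_fun]), ⟨fun v hv ↦ ⟨?_, ?_⟩, fun v ↦ ?_⟩, fun a v ↦ ?_⟩
  · rintro ⟨w, hw, hwb, hwv⟩
    obtain ⟨c, hc⟩ := (Projectivization.mk_eq_mk_iff' _ _ _ _ _).mp hwv.symm
    obtain ⟨x, rfl⟩ := (Submodule.mem_span_range_iff_exists_fun F).mp hwb
    exact ⟨c, φ x, by rw [← hc, map_smul, hrat]⟩
  · rintro ⟨c, x, hc⟩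
    obtain ⟨y, rfl⟩ := φe.surjective x
    rw [hφe, ← hrat, ← map_smul] at hc
    have hv' := Φ.injective hc
    have hw : ∑ i, y i • b i ≠ 0 := fun h0 ↦ hv (by rw [hv', h0, smul_zero])
    refine ⟨_, hw, (Submodule.mem_span_range_iff_exists_fun F).mpr ⟨y, rfl⟩, ?_⟩
    exact ((Projectivization.mk_eq_mk_iff' _ _ _ _ _).mpr ⟨c, hv'.symm⟩).symm
  · rw [← hf, LinearMap.mem_ker, hfu, hΦ, hT0]
  · have : ∀ a, LinearEquiv.ofInjectiveOfFinrankEq p hpinj (by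
      rw [hσ.finrank_eq, Module.finrank_fin_fun]) a = p a := fun a ↦ rfl
    rw [this, dualLine, LinearMap.mem_ker, hΦ, conjForm, hT0, hT1, hT2]
    simp only [LinearMap.add_apply, LinearMap.smul_apply, smul_eq_mul, hp, hσ.trace_eq,
      Fin.sum_univ_three, Module.Basis.coord_apply, map_mul]
    refine Eq.congr_left ?_
    ring

/-! ### Sublines arising from dual subconics -/

/-- A non-degenerate conic contains no line. -/
theorem not_forall_eq_zero_of_nondegenerate {Q : QuadraticForm F (Fin 3 → F)}
    (hQ : Q.Nondegenerate) {p r : Fin 3 → F} (hpr : LinearIndependent F ![p, r])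
    (h : ∀ s t : F, Q (s • p + t • r) = 0) : False := by
  have hline : IsLine (Submodule.span F (Set.range ![p, r])) := by
    rw [IsLine, finrank_span_eq_card hpr, Fintype.card_fin]
  obtain ⟨f, hf⟩ := exists_ker_eq_of_isLine hline
  have hW : ∀ n, f n = 0 → ∃ s t : F, s • p + t • r = n := by
    intro n hn
    rw [← LinearMap.mem_ker, hf, Matrix.range_cons_cons_empty, Submodule.mem_span_pair] at hn
    exact hn
  have hW' : ∀ s t : F, f (s • p + t • r) = 0 := by
    intro s t
    rw [← LinearMap.mem_ker, hf, Matrix.range_cons_cons_empty, Submodule.mem_span_pair]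
    exact ⟨s, t, rfl⟩
  have hf0 : f ≠ 0 := by
    rintro rfl
    rw [LinearMap.ker_zero] at hf
    rw [IsLine, ← hf, finrank_top, Module.finrank_fin_fun] at hline
    omega
  obtain ⟨v, hv⟩ : ∃ v, f v = 1 := LinearMap.surjective hf0 1
  have hpol : ∀ s t s' t' : F,
      Q.polarBilin (s • p + t • r) (s' • p + t' • r) = 0 := by
    intro s t s' t'
    rw [QuadraticMap.polarBilin_apply_apply, QuadraticMap.polar, h, h,
      show s • p + t • r + (s' • p + t' • r) = (s + s') • p + (t + t') • r by module, h]
    simp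
  have hrad : ∀ s t : F, Q.polarBilin (s • p + t • r) v = 0 → s • p + t • r = 0 := by
    intro s t hst
    rw [← Submodule.mem_bot F, ← hQ.radical_eq_bot]
    refine ⟨h s t, LinearMap.ext fun n ↦ ?_⟩
    obtain ⟨s', t', hn⟩ := hW (n - f n • v) (by simp [hv])
    rw [eq_add_of_sub_eq hn.symm, map_add, map_smul, hpol, hst]
    simp
  have hz : ∀ s t : F, Q.polarBilin (s • p + t • r) v = 0 → s = 0 ∧ t = 0 := fun s t hst ↦
    LinearIndependent.pair_iff.mp hpr s t (hrad s t hst)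
  -- The polar form vanishes on the plane of p and r, and pairing with v is a linear form on that
  -- plane, so it kills this combination. By `hz` it must be trivial, which puts p and r in the
  -- kernel too. Working with the radical covers characteristic 2.
  have h1 := hz (Q.polarBilin r v) (-Q.polarBilin p v) (by
    simp only [map_add, map_smul, LinearMap.add_apply, LinearMap.smul_apply, smul_eq_mul]
    ring)
  have h2 := hz 0 1 (by simpa using h1.1)
  exact one_ne_zero h2.2

namespace IsCubicFrobenius

variable {σ : K →ₐ[F] K} (hσ : IsCubicFrobenius σ)
include hσ

theorem trace_form_eq_zero_iff {x y w : K} (h : x * σ y ≠ y * σ x) {c : K}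
    (hc : c = σ x * σ (σ y) - σ (σ x) * σ y) :
    c * w + σ (c * w) + σ (σ (c * w)) = 0 ↔
      ∃ s t : F, w = algebraMap F K s * x + algebraMap F K t * y := by
  have hc1 : σ c = σ (σ x) * y - x * σ (σ y) := by simp [hc, hσ.cube]
  have hc2 : σ (σ c) = x * σ y - σ x * y := by simp [hc1, hσ.cube]
  simp only [map_mul]
  constructor
  · intro hw
    have hd : σ (σ c) ≠ 0 := by rw [hc2, sub_ne_zero, mul_comm (σ x)]; exact h
    have hd0 : c ≠ 0 := by rintro rfl; simp at hd
    have hs : ∀ y, c * y + σ c * σ y + σ (σ c) * σ (σ y) = 0 →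
        σ ((w * σ y - y * σ w) / σ (σ c)) = (w * σ y - y * σ w) / σ (σ c) := by
      intro y hy
      simp only [map_div₀, map_sub, map_mul, hσ.cube]
      rw [div_eq_div_iff hd0 hd]
      linear_combination σ w * hy - σ y * hw
    obtain ⟨s, hs1⟩ := hσ.exists_algebraMap_eq (hs y (by rw [hc2, hc1, hc]; ring))
    obtain ⟨t, ht1⟩ := hσ.exists_algebraMap_eq (hs x (by rw [hc2, hc1, hc]; ring))
    refine ⟨s, -t, ?_⟩
    rw [map_neg, hs1, ht1]
    field_simp
    rw [hc2]
    ring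
  · rintro ⟨s, t, rfl⟩
    simp only [map_add, map_mul, AlgHom.commutes]
    rw [hc2, hc1, hc]
    ring

/-- N(B) + N(G) is a binary cubic in (s, t) vanishing at the four points (1,0), (0,1), (1,1), (1,r),
hence identically; this needs more than two elements in F. Evaluating it at the zero (-β₁, β₀) of B
kills N(B), so some conjugate of G is proportional to B. -/
theorem ratio_of_norm_eq (hF : ∃ r : F, r ≠ 0 ∧ r ≠ 1) {β₀ β₁ γ₀ γ₁ : K}
    (hdet : β₀ * γ₁ ≠ β₁ * γ₀)
    (h : ∀ s t : F, ∀ B G : K, B = algebraMap F K s * β₀ + algebraMap F K t * β₁ →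
      G = algebraMap F K s * γ₀ + algebraMap F K t * γ₁ →
      B * σ B * σ (σ B) = -(G * σ G * σ (σ G))) :
    γ₁ * σ β₀ = γ₀ * σ β₁ ∨ γ₁ * σ (σ β₀) = γ₀ * σ (σ β₁) := by
  obtain ⟨r, hr0, hr1⟩ := hF
  have hr0' : algebraMap F K r ≠ 0 := by simpa using hr0
  have hr1' : algebraMap F K r - 1 ≠ 0 := by
    rw [sub_ne_zero, ← map_one (algebraMap F K)]
    exact fun e ↦ hr1 ((algebraMap F K).injective e)
  have h10 := h 1 0 _ _ rfl rfl
  have h01 := h 0 1 _ _ rfl rfl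
  have h11 := h 1 1 _ _ rfl rfl
  have h1r := h 1 r _ _ rfl rfl
  simp only [map_add, map_mul, AlgHom.commutes, map_one, map_zero, one_mul, zero_mul, add_zero,
    zero_add] at h10 h01 h11 h1r
  generalize algebraMap F K r = ρ at *
  obtain ⟨c1, hc1⟩ : ∃ c, c = β₁ * σ β₀ * σ (σ β₀) + β₀ * σ β₁ * σ (σ β₀) + β₀ * σ β₀ * σ (σ β₁) +
    (γ₁ * σ γ₀ * σ (σ γ₀) + γ₀ * σ γ₁ * σ (σ γ₀) + γ₀ * σ γ₀ * σ (σ γ₁)) := ⟨_, rfl⟩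
  obtain ⟨c2, hc2⟩ : ∃ c, c = β₀ * σ β₁ * σ (σ β₁) + β₁ * σ β₀ * σ (σ β₁) + β₁ * σ β₁ * σ (σ β₀) +
    (γ₀ * σ γ₁ * σ (σ γ₁) + γ₁ * σ γ₀ * σ (σ γ₁) + γ₁ * σ γ₁ * σ (σ γ₀)) := ⟨_, rfl⟩
  have e1 : c1 + c2 = 0 := by rw [hc1, hc2]; linear_combination h11 - h10 - h01
  have e2 : c1 * ρ + c2 * ρ ^ 2 = 0 := by
    rw [hc1, hc2]; linear_combination h1r - h10 - ρ ^ 3 * h01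
  have z2 : c2 = 0 := by
    have : ρ * (ρ - 1) * c2 = 0 := by linear_combination e2 - ρ * e1
    simpa [hr0', hr1'] using this
  have z1 : c1 = 0 := by linear_combination e1 - z2
  rw [hc1] at z1
  rw [hc2] at z2
  have key : (β₀ * γ₁ - β₁ * γ₀) * (β₀ * σ γ₁ - β₁ * σ γ₀) *
      (β₀ * σ (σ γ₁) - β₁ * σ (σ γ₀)) = 0 := by
    linear_combination β₀ ^ 3 * h01 - β₀ ^ 2 * β₁ * z2 + β₀ * β₁ ^ 2 * z1 - β₁ ^ 3 * h10
  rcases mul_eq_zero.mp key with h1 | h1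
  · rcases mul_eq_zero.mp h1 with h1 | h1
    · exact absurd (sub_eq_zero.mp h1) hdet
    · right
      have := congrArg (fun x ↦ σ (σ x)) h1
      simp only [map_sub, map_mul, map_zero, hσ.cube] at this
      linear_combination this
  · left
    have := congrArg σ h1
    simp only [map_sub, map_mul, map_zero, hσ.cube] at this
    linear_combination this

/-- The solutions of `y + δ * σ y = 0` form an `F`-space of dimension at most one. -/
theorem exists_eq_algebraMap_mul {δ y y₀ : K} (hy₀ : y₀ ≠ 0) (h₀ : y₀ + δ * σ y₀ = 0)
    (h : y + δ * σ y = 0) : ∃ c : F, y = algebraMap F K c * y₀ := by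
  have hδ : δ ≠ 0 := by rintro rfl; simp [hy₀] at h₀
  apply hσ.exists_algebraMap_mul_eq hy₀
  apply mul_left_cancel₀ hδ
  linear_combination y₀ * h - y * h₀

end IsCubicFrobenius

namespace IsCubicFrobenius

variable {σ : K →ₐ[F] K} (hσ : IsCubicFrobenius σ)
include hσ

/-- Each point (0, B, G) of `s` lies on a line a of `D`: σa B + σ²a G = 0. Taking norms gives N(B) =
-N(G), so `ratio_of_norm_eq` applies, and G = δσB or G = δσ²B along all of `s`. The first case is
the claim; the second makes the lines a pencil. -/
theorem exists_mem_dualSubconic_trace_iff (hF : ∃ r : F, r ≠ 0 ∧ r ≠ 1) {π₀ : Set (Point K)}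
    {l : Submodule K (Fin 3 → K)} {Φ : (Fin 3 → K) ≃ₗ[K] (Fin 3 → K)}
    (hΦ : IsSplashFrame σ π₀ l Φ) {b : Module.Basis (Fin 3) K (Fin 3 → K)}
    {ψ : K ≃ₗ[F] (Fin 3 → F)} (hψ : ∀ a v, v ∈ dualLine b (ψ a) ↔ conjForm σ a (Φ v) = 0)
    {Q : QuadraticForm F (Fin 3 → F)} (hQ : Q.Nondegenerate) {s : Set (Point K)}
    (hs : IsSubline F l s)
    (hsD : s = trace {m | ∃ u : Fin 3 → F, u ≠ 0 ∧ Q u = 0 ∧ m = dualLine b u} l) :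
    ∃ c : K, c ≠ 0 ∧ ∀ v (hv : v ≠ 0), Projectivization.mk K v hv ∈ s ↔
      ∃ e w : K, c * w + σ (c * w) + σ (σ (c * w)) = 0 ∧ Φ v = e • splashVec σ w := by
  obtain ⟨d, hd, hdl, hds⟩ := hs
  have hd0 : ∀ i, Φ (d i) 0 = 0 := fun i ↦ by
    rw [← hΦ.mem_line, ← hdl]; exact Submodule.subset_span ⟨i, rfl⟩
  obtain ⟨β₀, hβ₀⟩ : ∃ x, x = Φ (d 0) 1 := ⟨_, rfl⟩
  obtain ⟨β₁, hβ₁⟩ : ∃ x, x = Φ (d 1) 1 := ⟨_, rfl⟩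
  obtain ⟨γ₀, hγ₀⟩ : ∃ x, x = Φ (d 0) 2 := ⟨_, rfl⟩
  obtain ⟨γ₁, hγ₁⟩ : ∃ x, x = Φ (d 1) 2 := ⟨_, rfl⟩
  have hd' : ∀ x y : K, x • d 0 + y • d 1 = 0 → x = 0 ∧ y = 0 := by
    have : d = ![d 0, d 1] := by ext i; fin_cases i <;> rfl
    rw [this] at hd
    exact LinearIndependent.pair_iff.mp hd
  have hcoord : ∀ x y : K,
      Φ (x • d 0 + y • d 1) = ![0, x * β₀ + y * β₁, x * γ₀ + y * γ₁] := by
    intro x y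
    ext j
    fin_cases j <;> simp [hd0, hβ₀, hβ₁, hγ₀, hγ₁]
  have hcoord0 : ∀ x y : K, x * β₀ + y * β₁ = 0 → x * γ₀ + y * γ₁ = 0 → x = 0 ∧ y = 0 := by
    intro x y h1 h2
    refine hd' x y (Φ.injective ?_)
    rw [hcoord, h1, h2, map_zero]
    ext j
    fin_cases j <;> rfl
  have hdet : β₀ * γ₁ ≠ β₁ * γ₀ := by
    intro h
    have h1 := hcoord0 β₁ (-β₀) (by ring) (by linear_combination -h)
    have h2 := hcoord0 γ₁ (-γ₀) (by linear_combination h) (by ring)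
    have h3 := hcoord0 1 0 (by linear_combination -h1.2) (by linear_combination -h2.2)
    exact one_ne_zero h3.1
  -- the points of the subline
  have hmem : ∀ v (hv : v ≠ 0), Projectivization.mk K v hv ∈ s ↔ ∃ (e : K) (x y : F),
      v = e • (algebraMap F K x • d 0 + algebraMap F K y • d 1) := by
    intro v hv
    rw [hds]
    constructor
    · rintro ⟨w, hw, hwd, hwv⟩
      obtain ⟨c, rfl⟩ := (Submodule.mem_span_range_iff_exists_fun F).mp hwd
      obtain ⟨e, he⟩ := (Projectivization.mk_eq_mk_iff' _ _ _ _ _).mp hwv.symm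
      refine ⟨e, c 0, c 1, ?_⟩
      rw [← he, Fin.sum_univ_two]
      simp only [algebraMap_smul]
    · rintro ⟨e, x, y, h⟩
      have hw : algebraMap F K x • d 0 + algebraMap F K y • d 1 ≠ 0 := fun h0 ↦ hv (by
        rw [h, h0, smul_zero])
      refine ⟨_, hw, (Submodule.mem_span_range_iff_exists_fun F).mpr ⟨![x, y], ?_⟩, ?_⟩
      · simp [Fin.sum_univ_two]
      · exact ((Projectivization.mk_eq_mk_iff' _ _ _ _ _).mpr ⟨e, h.symm⟩).symm
  have hline : ∀ (x y : F) (B G : K), B = algebraMap F K x * β₀ + algebraMap F K y * β₁ →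
      G = algebraMap F K x * γ₀ + algebraMap F K y * γ₁ → (x ≠ 0 ∨ y ≠ 0) →
      B ≠ 0 ∧ ∃ a, a ≠ 0 ∧ Q (ψ a) = 0 ∧ σ a * B + σ (σ a) * G = 0 := by
    intro x y B G hB hG hxy
    have hw : algebraMap F K x • d 0 + algebraMap F K y • d 1 ≠ 0 := by
      intro h0
      have := hd' _ _ h0
      simp only [map_eq_zero] at this
      tauto
    have hs := (hmem _ hw).mpr ⟨1, x, y, (one_smul _ _).symm⟩
    rw [hsD] at hs
    obtain ⟨-, m, ⟨u, hu, hQu, rfl⟩, hm⟩ := hs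
    obtain ⟨a, rfl⟩ := ψ.surjective u
    have ha : a ≠ 0 := by rintro rfl; simp at hu
    rw [onLine_mk, hψ, hcoord, conjForm, ← hB, ← hG] at hm
    have hm' : σ a * B + σ (σ a) * G = 0 := by simpa using hm
    refine ⟨?_, a, ha, hQu, hm'⟩
    rintro rfl
    have hG0 : G = 0 := by simpa [ha] using hm'
    rw [hG0] at hG
    have := hcoord0 _ _ hB.symm hG.symm
    simp only [map_eq_zero] at this
    tauto
  have hratio := hσ.ratio_of_norm_eq hF hdet (by
    intro x y B G hB hG
    by_cases hxy : x ≠ 0 ∨ y ≠ 0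
    · obtain ⟨-, a, ha, -, h⟩ := hline x y B G hB hG hxy
      have h1 := congrArg σ h
      have h2 := congrArg σ h1
      simp only [map_add, map_mul, map_zero, hσ.cube] at h1 h2
      have hn : a * σ a * σ (σ a) ≠ 0 := by simp [ha]
      apply mul_left_cancel₀ hn
      linear_combination (σ (σ a) * σ B * a * σ (σ B)) * h
        - σ (σ a) * G * a * σ (σ B) * h1 + σ (σ a) * G * a * σ G * h2
    · push Not at hxy
      rw [hxy.1, hxy.2] at hB hG
      simp only [map_zero, zero_mul, add_zero] at hB hG
      simp [hB, hG])
  have hB0 : β₀ ≠ 0 := (hline 1 0 β₀ γ₀ (by simp) (by simp) (by simp)).1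
  rcases hratio with hr | hr
  · obtain ⟨δ, hδ⟩ : ∃ δ, δ = γ₀ / σ β₀ := ⟨_, rfl⟩
    have hσB0 : σ β₀ ≠ 0 := (map_ne_zero σ).mpr hB0
    have hG : ∀ x y : F, algebraMap F K x * γ₀ + algebraMap F K y * γ₁ =
        δ * σ (algebraMap F K x * β₀ + algebraMap F K y * β₁) := by
      intro x y
      rw [hδ]
      simp only [map_add, map_mul, AlgHom.commutes]
      field_simp
      linear_combination algebraMap F K y * hr
    obtain ⟨-, a, ha, -, h⟩ := hline 1 0 β₀ (δ * σ β₀) (by simp) (by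
      rw [hG]; simp) (by simp)
    -- A solution of y + δσy = 0. It turns (0, B, δσB) into y₀ (0, σw, -σ²w) with w = σ²(B/y₀),
    -- which is F-linear in B.
    obtain ⟨y₀, hy₀⟩ : ∃ y, y = σ a * β₀ := ⟨_, rfl⟩
    have hy₀0 : y₀ ≠ 0 := by rw [hy₀]; simp [ha, hB0]
    have hy₀e : y₀ + δ * σ y₀ = 0 := by rw [hy₀, map_mul]; linear_combination h
    have hσy₀ : σ y₀ ≠ 0 := (map_ne_zero σ).mpr hy₀0
    have hind : σ (σ (β₀ / y₀)) * σ (σ (σ (β₁ / y₀))) ≠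
        σ (σ (β₁ / y₀)) * σ (σ (σ (β₀ / y₀))) := by
      rw [← map_mul, ← map_mul, ← map_mul, ← map_mul]
      intro h
      have h := σ.injective (σ.injective h)
      rw [map_div₀, map_div₀] at h
      field_simp at h
      apply hdet
      apply mul_right_cancel₀ hσB0
      linear_combination β₀ * hr + γ₀ * h
    obtain ⟨c, hc⟩ : ∃ c, c = _ := ⟨σ (σ (σ (β₀ / y₀))) * σ (σ (σ (σ (β₁ / y₀)))) -
      σ (σ (σ (σ (β₀ / y₀)))) * σ (σ (σ (β₁ / y₀))), rfl⟩
    have hc0 : c ≠ 0 := by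
      intro h0
      rw [hc] at h0
      apply hind
      apply σ.injective
      simp only [map_mul]
      linear_combination h0
    have hvec : ∀ x y : F, y₀ • splashVec σ (algebraMap F K x * σ (σ (β₀ / y₀)) +
        algebraMap F K y * σ (σ (β₁ / y₀))) =
        Φ (algebraMap F K x • d 0 + algebraMap F K y • d 1) := by
      intro x y
      rw [hcoord, hG]
      ext j
      fin_cases j
      · simp [splashVec]
      · simp [splashVec, hσ.cube]
        field_simp
      · simp [splashVec, hσ.cube]
        field_simp
        linear_combination (-(algebraMap F K x * σ β₀ + algebraMap F K y * σ β₁)) * hy₀e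
    refine ⟨c, hc0, fun v hv ↦ ?_⟩
    rw [hmem]
    constructor
    · rintro ⟨e, x, y, rfl⟩
      refine ⟨e * y₀, _, (hσ.trace_form_eq_zero_iff hind hc).mpr ⟨x, y, rfl⟩, ?_⟩
      rw [map_smul, ← hvec, mul_smul]
    · rintro ⟨e, w, hw, he⟩
      obtain ⟨x, y, rfl⟩ := (hσ.trace_form_eq_zero_iff hind hc).mp hw
      refine ⟨e * y₀⁻¹, x, y, Φ.injective ?_⟩
      rw [he, map_smul, ← hvec, mul_smul, inv_smul_smul₀ hy₀0]
  · exfalso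
    obtain ⟨δ, hδ⟩ : ∃ δ, δ = γ₀ / σ (σ β₀) := ⟨_, rfl⟩
    have hσB0 : σ (σ β₀) ≠ 0 := by simpa using hB0
    have hG : ∀ x y : F, algebraMap F K x * γ₀ + algebraMap F K y * γ₁ =
        δ * σ (σ (algebraMap F K x * β₀ + algebraMap F K y * β₁)) := by
      intro x y
      rw [hδ]
      simp only [map_add, map_mul, AlgHom.commutes]
      field_simp
      linear_combination algebraMap F K y * hr
    -- Here σ(a/σB) solves a fixed equation y + δσy = 0, whose solutions form an F-line. Hence a is
    -- an F-multiple of y₀ σB: the dual conic would contain the whole F-plane of such values.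
    have hlin : ∀ B a : K, B ≠ 0 → σ a * B + σ (σ a) * (δ * σ (σ B)) = 0 →
        σ (a / σ B) + δ * σ (σ (a / σ B)) = 0 := by
      intro B a hB h
      have hB2 : σ (σ B) ≠ 0 := by simpa using hB
      simp only [map_div₀, hσ.cube]
      field_simp
      linear_combination h
    obtain ⟨-, a, ha, -, h⟩ := hline 1 0 β₀ (δ * σ (σ β₀)) (by simp) (by
      rw [hG]; simp) (by simp)
    obtain ⟨y₀, hy₀⟩ : ∃ y, y = a / σ β₀ := ⟨_, rfl⟩
    have hy₀0 : y₀ ≠ 0 := by rw [hy₀]; simp [ha, hB0]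
    have hy₀e := hlin _ _ hB0 h
    rw [← hy₀] at hy₀e
    have hmul : ∀ x y : F, x • ψ (y₀ * σ β₀) + y • ψ (y₀ * σ β₁) =
        ψ (y₀ * σ (algebraMap F K x * β₀ + algebraMap F K y * β₁)) := by
      intro x y
      rw [← map_smul, ← map_smul, ← map_add]
      congr 1
      simp only [map_add, map_mul, AlgHom.commutes, Algebra.smul_def]
      ring
    refine not_forall_eq_zero_of_nondegenerate hQ (p := ψ (y₀ * σ β₀)) (r := ψ (y₀ * σ β₁)) ?_ ?_
    · rw [LinearIndependent.pair_iff]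
      intro x y hxy
      rw [hmul] at hxy
      by_contra hne
      have := (hline x y _ _ rfl rfl (by tauto)).1
      rw [LinearEquiv.map_eq_zero_iff] at hxy
      have h3 := (mul_eq_zero.mp hxy).resolve_left hy₀0
      exact this ((map_eq_zero σ).mp h3)
    · intro x y
      rw [hmul]
      by_cases hxy : x ≠ 0 ∨ y ≠ 0
      · obtain ⟨hB, a, ha, hQa, h⟩ := hline x y _ _ rfl (hG x y).symm hxy
        have h' := hlin _ _ hB h
        obtain ⟨c, hc⟩ := hσ.exists_eq_algebraMap_mul (by simpa using hy₀0) hy₀e h'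
        rw [← AlgHom.commutes σ c, ← map_mul] at hc
        have hc := σ.injective hc
        have hσB : σ (algebraMap F K x * β₀ + algebraMap F K y * β₁) ≠ 0 :=
          (map_ne_zero σ).mpr hB
        have ha' : a = c • (y₀ * σ (algebraMap F K x * β₀ + algebraMap F K y * β₁)) := by
          rw [Algebra.smul_def, ← mul_assoc, ← hc, div_mul_cancel₀ _ hσB]
        have hc0 : c ≠ 0 := by rintro rfl; simp [ha] at ha'
        rw [ha', map_smul, QuadraticMap.map_smul, smul_eq_mul] at hQa
        simpa [hc0] using hQa
      · push Not at hxy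
        simp [hxy.1, hxy.2]

/-- The frame can be scaled so that the subline consists of the points `(0, σ w, -σ² w)` with
`w` of trace zero. -/
theorem exists_normalized_frame (hF : ∃ r : F, r ≠ 0 ∧ r ≠ 1) {π₀ : Set (Point K)}
    {l : Submodule K (Fin 3 → K)} (hl : IsLine l) (hdisj : ∀ P ∈ π₀, ¬ OnLine P l)
    {s : Set (Point K)} (hs : IsSubline F l s) {D : Set (Submodule K (Fin 3 → K))}
    (hD : IsDualSubconic F π₀ D) (hsD : s = trace D l) :
    ∃ Φ : (Fin 3 → K) ≃ₗ[K] (Fin 3 → K), IsSplashFrame σ π₀ l Φ ∧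
      (∀ v (hv : v ≠ 0), Projectivization.mk K v hv ∈ s ↔
        ∃ e w : K, w + σ w + σ (σ w) = 0 ∧ Φ v = e • splashVec σ w) ∧
      ∀ m ∈ D, ∃ a : K, a ≠ 0 ∧ ∀ v ∈ m, conjForm σ a (Φ v) = 0 := by
  obtain ⟨b, Q, rfl, hQ, rfl⟩ := hD
  obtain ⟨Φ, ψ, hΦ, hψ⟩ := hσ.exists_isSplashFrame b hl hdisj
  obtain ⟨c, hc, hcs⟩ := hσ.exists_mem_dualSubconic_trace_iff hF hΦ hψ hQ hs hsD
  have hc1 : σ c ≠ 0 := by simpa using hc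
  have hc2 : σ (σ c) ≠ 0 := by simpa using hc
  let u : Fin 3 → Kˣ := ![Units.mk0 c hc, Units.mk0 (σ c) hc1, Units.mk0 (σ (σ c)) hc2]
  -- The matrix diag(c, σc, σ²c) preserves {(x, σx, σ²x)} and replaces w by cw; line coefficients a
  -- become a/c.
  let Δ : (Fin 3 → K) ≃ₗ[K] (Fin 3 → K) :=
    LinearEquiv.piCongrRight fun i ↦ LinearEquiv.smulOfUnit (u i)
  have hΔ : ∀ v, Δ v = ![c * v 0, σ c * v 1, σ (σ c) * v 2] := by
    intro v
    ext i
    fin_cases i <;> rfl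
  have hconj : ∀ k x : K, Δ (k • conjVec σ x) = k • conjVec σ (c * x) := by
    intro k x
    rw [map_smul, hΔ]
    ext i
    fin_cases i <;> simp [conjVec]
  have hspl : ∀ k w : K, Δ (k • splashVec σ w) = k • splashVec σ (c * w) := by
    intro k w
    rw [map_smul, hΔ]
    ext i
    fin_cases i <;> simp [splashVec]
  refine ⟨Φ.trans Δ, ⟨fun v hv ↦ ?_, fun v ↦ ?_⟩, fun v hv ↦ ?_, ?_⟩
  · rw [hΦ.mem_subplane]
    constructor
    · rintro ⟨k, x, h⟩
      exact ⟨k, c * x, by rw [LinearEquiv.trans_apply, h, hconj]⟩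
    · rintro ⟨k, x, h⟩
      refine ⟨k, x / c, Δ.injective ?_⟩
      rw [hconj, mul_div_cancel₀ _ hc, ← h, LinearEquiv.trans_apply]
  · rw [hΦ.mem_line, LinearEquiv.trans_apply, hΔ]
    simp [hc]
  · rw [hcs]
    constructor
    · rintro ⟨e, w, hw, h⟩
      exact ⟨e, c * w, hw, by rw [LinearEquiv.trans_apply, h, hspl]⟩
    · rintro ⟨e, w, hw, h⟩
      refine ⟨e, w / c, by rwa [mul_div_cancel₀ _ hc], Δ.injective ?_⟩
      rw [hspl, mul_div_cancel₀ _ hc, ← h, LinearEquiv.trans_apply]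
  · rintro m ⟨u, hu, -, rfl⟩
    obtain ⟨a, rfl⟩ := ψ.surjective u
    refine ⟨a / c, div_ne_zero (by rintro rfl; simp at hu) hc, fun v hv ↦ ?_⟩
    rw [hψ] at hv
    rw [LinearEquiv.trans_apply, hΔ, ← hv]
    simp only [conjForm, map_div₀, Matrix.cons_val]
    field_simp

end IsCubicFrobenius

/-! ### Lines and collinearity -/

theorem isLine_span_pair {v w : Fin 3 → K} (h : LinearIndependent K ![v, w]) :
    IsLine (Submodule.span K {v, w}) := by
  rw [IsLine, ← Matrix.range_cons_cons_empty v w ![], finrank_span_eq_card h, Fintype.card_fin]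

theorem IsLine.eq_span_pair {m : Submodule K (Fin 3 → K)} (hm : IsLine m) {v w : Fin 3 → K}
    (hv : v ∈ m) (hw : w ∈ m) (h : LinearIndependent K ![v, w]) :
    m = Submodule.span K {v, w} := by
  refine (Submodule.eq_of_le_of_finrank_eq ?_ ((isLine_span_pair h).trans hm.symm)).symm
  rw [Submodule.span_le]
  rintro x (rfl | rfl) <;> assumption

theorem IsLine.det_eq_zero {m : Submodule K (Fin 3 → K)} (hm : IsLine m)
    (Φ : (Fin 3 → K) ≃ₗ[K] (Fin 3 → K)) {u v w : Fin 3 → K} (hu : u ∈ m) (hv : v ∈ m)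
    (hw : w ∈ m) : (Matrix.of ![Φ u, Φ v, Φ w]).det = 0 := by
  obtain ⟨f, hf⟩ := exists_ker_eq_of_isLine hm
  let g := f ∘ₗ Φ.symm.toLinearMap
  have hg : ∀ x, g x = x 0 * g (Pi.single 0 1) + x 1 * g (Pi.single 1 1) +
      x 2 * g (Pi.single 2 1) := by
    intro x
    conv_lhs => rw [LinearMap.pi_apply_eq_sum_univ g x]
    have : ∀ i : Fin 3, (fun j ↦ if i = j then (1 : K) else 0) = Pi.single i 1 := by
      intro i; ext j; simp [Pi.single_apply, eq_comm]
    simp only [Fin.sum_univ_three, smul_eq_mul, this]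
  have hgΦ : ∀ x ∈ m, g (Φ x) = 0 := by
    intro x hx
    rw [← hf] at hx
    simpa [g] using hx
  have hdot : ∀ x ∈ m, Φ x 0 * g (Pi.single 0 1) + Φ x 1 * g (Pi.single 1 1) +
      Φ x 2 * g (Pi.single 2 1) = 0 := fun x hx ↦ by rw [← hg, hgΦ x hx]
  have hgf : ∀ x, g (Φ x) = f x := fun x ↦ by simp [g]
  clear_value g
  rw [← Matrix.exists_mulVec_eq_zero_iff]
  refine ⟨fun i ↦ g (Pi.single i 1), fun h0 ↦ ?_, ?_⟩
  · have hz : ∀ x, g x = 0 := fun x ↦ by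
      rw [hg, congrFun h0 0, congrFun h0 1, congrFun h0 2]; simp
    have : f = 0 := by
      refine LinearMap.ext fun x ↦ ?_
      rw [← hgf, hz, LinearMap.zero_apply]
    rw [this, LinearMap.ker_zero] at hf
    rw [IsLine, ← hf, finrank_top, Module.finrank_fin_fun] at hm
    omega
  · ext i
    fin_cases i
    · simpa [Matrix.mulVec, dotProduct, Fin.sum_univ_three] using hdot u hu
    · simpa [Matrix.mulVec, dotProduct, Fin.sum_univ_three] using hdot v hv
    · simpa [Matrix.mulVec, dotProduct, Fin.sum_univ_three] using hdot w hw

/-! ### Exceptional points -/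

/-- The coordinates of the points that lie on `q + 1` lines of `E`. -/
def exceptionalVec (σ : K →ₐ[F] K) (k : K) : Fin 3 → K :=
  ![k ^ 2, -(σ k * (k + σ (σ k))), -(σ (σ k) * (k + σ k))]

namespace IsCubicFrobenius

variable {σ : K →ₐ[F] K} (hσ : IsCubicFrobenius σ)
include hσ

/-- No extended subline passes through an exceptional point. With b = ak and tr k = 1 the equation
reads tr(bk) = σb + σ²b. Its left side is fixed by σ, hence so is b; then b = 2b. -/
theorem eq_zero_of_conjForm_exceptionalVec {a k : K} (hk : k ≠ 0) (ht : k + σ k + σ (σ k) = 1)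
    (h : conjForm σ a (exceptionalVec σ k) = 0) : a = 0 := by
  simp only [conjForm, exceptionalVec, Matrix.cons_val] at h
  have h1 := congrArg σ h
  simp only [map_add, map_mul, map_neg, map_pow, map_zero, hσ.cube] at h1
  have e : σ (a * k) = a * k := by
    simp only [map_mul]
    linear_combination h1 - h + (a * k - σ a * σ k) * ht
  have e2 : σ (σ (a * k)) = a * k := by rw [e, e]
  rw [map_mul] at e
  rw [map_mul, map_mul] at e2
  have : a * k = 0 := by
    linear_combination -h - (a * k) * ht - (k + σ (σ k)) * e - (k + σ k) * e2
  simpa [hk] using this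

/-- Recovers k from (Y, Z): the second identity determines σk σ²k, after which the first gives k. -/
theorem exceptional_invariants {Y Z k : K} (hk : k ≠ 0) (ht : k + σ k + σ (σ k) = 1)
    (hY : Y * k ^ 2 = -(σ k * (k + σ (σ k)))) (hZ : Z * k ^ 2 = -(σ (σ k) * (k + σ k))) :
    (1 - σ Y * σ (σ Z)) * (σ k * σ (σ k)) = -k ∧
    ((1 - Y * σ Z) * σ (σ Y) - (1 - σ Y * σ (σ Z))) * (σ k * σ (σ k)) = 1 := by
  have hk1 : σ k ≠ 0 := (map_ne_zero σ).mpr hk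
  have hk2 : σ (σ k) ≠ 0 := (map_ne_zero σ).mpr hk1
  have hY' : Y = -(σ k * (k + σ (σ k))) / k ^ 2 := by rw [eq_div_iff (pow_ne_zero 2 hk), hY]
  have hZ' : Z = -(σ (σ k) * (k + σ k)) / k ^ 2 := by rw [eq_div_iff (pow_ne_zero 2 hk), hZ]
  have hk0 : σ (σ k) = 1 - k - σ k := by linear_combination ht
  have e1 : (1 - σ Y * σ (σ Z)) * (σ k * σ (σ k)) = -k := by
    rw [hY', hZ']
    simp only [map_div₀, map_mul, map_neg, map_add, map_pow, hσ.cube]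
    field_simp
    rw [hk0]
    ring
  have e2 : (1 - Y * σ Z) * (k * σ k) = -σ (σ k) := by
    simpa [hσ.cube] using congrArg (fun x ↦ σ (σ x)) e1
  have e3 : σ (σ Y) * σ (σ k) ^ 2 = -(k * (σ (σ k) + σ k)) := by
    simpa [hσ.cube] using congrArg (fun x ↦ σ (σ x)) hY
  refine ⟨e1, ?_⟩
  rw [sub_mul, e1]
  have h : (1 - Y * σ Z) * σ (σ Y) * (σ k * σ (σ k)) = σ k + σ (σ k) := by
    apply mul_right_cancel₀ (mul_ne_zero hk hk2)
    linear_combination σ (σ Y) * σ (σ k) ^ 2 * e2 - σ (σ k) * e3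
  rw [h]
  linear_combination ht

theorem exceptional_injective {Y Z k j : K} (hk : k ≠ 0) (ht : k + σ k + σ (σ k) = 1)
    (hY : Y * k ^ 2 = -(σ k * (k + σ (σ k)))) (hZ : Z * k ^ 2 = -(σ (σ k) * (k + σ k)))
    (hj : j ≠ 0) (htj : j + σ j + σ (σ j) = 1)
    (hYj : Y * j ^ 2 = -(σ j * (j + σ (σ j)))) (hZj : Z * j ^ 2 = -(σ (σ j) * (j + σ j))) :
    k = j := by
  obtain ⟨a1, a2⟩ := hσ.exceptional_invariants hk ht hY hZ
  obtain ⟨b1, b2⟩ := hσ.exceptional_invariants hj htj hYj hZj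
  have h := mul_left_cancel₀ (left_ne_zero_of_mul (a2 ▸ one_ne_zero)) (a2.trans b2.symm)
  rw [h] at a1
  linear_combination a1 - b1

/-- Exhibits x = k²(σw σ²k - σ²w σk) as the point of the subplane on the join of the exceptional
point k to the point w of `s`. -/
theorem join_exceptional {k w : K} (htw : w + σ w + σ (σ w) = 0) :
    (σ (σ w) * (σ k * (k + σ (σ k))) + σ w * (σ (σ k) * (k + σ k))) *
      (k ^ 2 * (σ w * σ (σ k) - σ (σ w) * σ k)) +
    k ^ 2 * (σ (σ w) * σ (k ^ 2 * (σ w * σ (σ k) - σ (σ w) * σ k)) +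
      σ w * σ (σ (k ^ 2 * (σ w * σ (σ k) - σ (σ w) * σ k)))) = 0 := by
  have hw : w = -σ w - σ (σ w) := by linear_combination htw
  simp only [map_mul, map_sub, map_pow, hσ.cube]
  generalize σ (σ w) = w2 at *
  generalize σ w = w1 at *
  subst hw
  ring

theorem ncard_trace_eq_one [Finite F] :
    {k : K | k + σ k + σ (σ k) = 1}.ncard = Nat.card F ^ 2 := by
  have : FiniteDimensional F K := FiniteDimensional.of_finrank_pos (by rw [hσ.finrank_eq]; simp)
  obtain ⟨y, hy⟩ := hσ.trace_surjective 1
  rw [← hσ.finrank_ker_trace, ← Module.natCard_eq_pow_finrank]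
  refine (Nat.card_congr (Equiv.ofBijective
    (fun x : LinearMap.ker (Algebra.trace F K) ↦
      (⟨x + y, by
        rw [Set.mem_ofPred_eq, ← hσ.trace_eq_one_iff, map_add, x.2, hy, zero_add]⟩ :
        {k : K | k + σ k + σ (σ k) = 1})) ⟨fun a b h ↦ ?_, fun k ↦ ?_⟩)).symm
  · simpa using h
  · refine ⟨⟨k - y, ?_⟩, ?_⟩
    · rw [LinearMap.mem_ker, map_sub, hy, hσ.trace_eq_one_iff.mpr k.2, sub_self]
    · simp

end IsCubicFrobenius

/-! ### Counting the lines of `E` through a point -/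

/-- A splash frame in which the subline `s` of `l` consists of the points `(0, σ w, -σ² w)` with
`w` of trace zero, and the lines of `D` are extended sublines of `π₀`. -/
structure IsNormalizedFrame (σ : K →ₐ[F] K) (π₀ : Set (Point K)) (l : Submodule K (Fin 3 → K))
    (s : Set (Point K)) (D : Set (Submodule K (Fin 3 → K)))
    (Φ : (Fin 3 → K) ≃ₗ[K] (Fin 3 → K)) : Prop extends IsSplashFrame σ π₀ l Φ where
  mem_subline : ∀ v (hv : v ≠ 0), Projectivization.mk K v hv ∈ s ↔
    ∃ e w : K, w + σ w + σ (σ w) = 0 ∧ Φ v = e • splashVec σ w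
  conjForm_eq_zero : ∀ m ∈ D, ∃ a : K, a ≠ 0 ∧ ∀ v ∈ m, conjForm σ a (Φ v) = 0

theorem splashVec_ne_zero {σ : K →ₐ[F] K} {w : K} (hw : w ≠ 0) : splashVec σ w ≠ 0 := by
  intro h
  have := congrFun h 1
  simp [splashVec, hw] at this

theorem exists_mk_eq (P : Point K) :
    ∃ (v : Fin 3 → K) (hv : v ≠ 0), Projectivization.mk K v hv = P :=
  ⟨P.rep, P.rep_nonzero, P.mk_rep⟩

theorem exists_mk_eq_of_not_onLine {σ : K →ₐ[F] K} {π₀ : Set (Point K)}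
    {l : Submodule K (Fin 3 → K)} {Φ : (Fin 3 → K) ≃ₗ[K] (Fin 3 → K)}
    (hΦ : IsSplashFrame σ π₀ l Φ) {P : Point K} (hP : ¬ OnLine P l) :
    ∃ (v : Fin 3 → K) (hv : v ≠ 0), P = Projectivization.mk K v hv ∧ Φ v 0 = 1 := by
  obtain ⟨v, hv, rfl⟩ := exists_mk_eq P
  rw [onLine_mk, hΦ.mem_line] at hP
  refine ⟨(Φ v 0)⁻¹ • v, smul_ne_zero (inv_ne_zero hP) hv, ?_, ?_⟩
  · exact ((Projectivization.mk_eq_mk_iff' _ _ _ _ _).mpr ⟨_, rfl⟩).symm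
  · simp [hP]

namespace IsCubicFrobenius

variable {σ : K →ₐ[F] K} (hσ : IsCubicFrobenius σ)
include hσ

theorem conjForm_eq_zero_of_mem_extendedSublines {π₀ : Set (Point K)}
    {l : Submodule K (Fin 3 → K)} {Φ : (Fin 3 → K) ≃ₗ[K] (Fin 3 → K)}
    (hΦ : IsSplashFrame σ π₀ l Φ) {m : Submodule K (Fin 3 → K)}
    (hm : m ∈ extendedSublines F π₀) :
    ∃ a : K, a ≠ 0 ∧ ∀ v ∈ m, conjForm σ a (Φ v) = 0 := by
  obtain ⟨-, d, hd, hdm, hds⟩ := hm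
  have hpt : ∀ i, ∃ c x : K, Φ (d i) = c • conjVec σ x := by
    intro i
    have : Projectivization.mk K (d i) (hd.ne_zero i) ∈ subgeometry F d :=
      ⟨d i, hd.ne_zero i, Submodule.subset_span ⟨i, rfl⟩, rfl⟩
    rw [← hds] at this
    exact (hΦ.mem_subplane _ _).mp this.1
  obtain ⟨c₀, x₀, h₀⟩ := hpt 0
  obtain ⟨c₁, x₁, h₁⟩ := hpt 1
  -- The first coordinate of the cross product of two conjugate vectors; the other two are its
  -- conjugates.
  refine ⟨σ x₀ * σ (σ x₁) - σ (σ x₀) * σ x₁, fun ha ↦ ?_, fun v hv ↦ ?_⟩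
  · have hx₁ : x₁ ≠ 0 := by
      rintro rfl
      apply hd.ne_zero 1
      apply Φ.injective
      rw [h₁, map_zero]
      ext i
      fin_cases i <;> simp [conjVec]
    have ha' : σ (x₀ * σ x₁ - σ x₀ * x₁) = 0 := by simpa using ha
    rw [map_eq_zero] at ha'
    obtain ⟨t, rfl⟩ := hσ.exists_algebraMap_mul_eq hx₁ (y := x₀) (by linear_combination -ha')
    have h2 : c₁ • d 0 + (-(c₀ * algebraMap F K t)) • d 1 = 0 := by
      apply Φ.injective
      rw [map_add, map_smul, map_smul, h₀, h₁, map_zero]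
      ext i
      fin_cases i <;> simp [conjVec] <;> ring
    have h3 : d = ![d 0, d 1] := by ext i; fin_cases i <;> rfl
    rw [h3] at hd
    have h4 := (LinearIndependent.pair_iff.mp hd _ _ h2).1
    rw [h4, zero_smul] at h₁
    exact hd.ne_zero 1 (Φ.injective (by rw [map_zero, ← h₁]; rfl))
  · rw [← hdm, Submodule.mem_span_range_iff_exists_fun] at hv
    obtain ⟨c, rfl⟩ := hv
    rw [Fin.sum_univ_two, map_add, map_smul, map_smul, h₀, h₁]
    simp [conjForm, conjVec, hσ.cube]
    ring

section Normalized

variable {π₀ : Set (Point K)} {l : Submodule K (Fin 3 → K)} {s : Set (Point K)}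
  {D : Set (Submodule K (Fin 3 → K))} {Φ : (Fin 3 → K) ≃ₗ[K] (Fin 3 → K)}
  (hΦ : IsNormalizedFrame σ π₀ l s D Φ)

omit hσ in
theorem linearIndependent_splash {v : Fin 3 → K} (hv : Φ v 0 = 1) {w : K} (hw : w ≠ 0) :
    LinearIndependent K ![v, Φ.symm (splashVec σ w)] := by
  rw [LinearIndependent.pair_iff]
  intro x y h
  have h' := congrArg Φ h
  rw [map_add, map_smul, map_smul, LinearEquiv.apply_symm_apply, map_zero] at h'
  have h0 : x = 0 := by simpa [splashVec, hv] using congrFun h' 0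
  rw [h0, zero_smul, zero_add, smul_eq_zero] at h'
  exact ⟨h0, h'.resolve_right (splashVec_ne_zero hw)⟩

omit hσ in
theorem join_eq_zero {m : Submodule K (Fin 3 → K)} (hm : IsLine m) {v : Fin 3 → K}
    (hv : Φ v 0 = 1) (hvm : v ∈ m) {w x : K} (hw : Φ.symm (splashVec σ w) ∈ m)
    (hx : Φ.symm (conjVec σ x) ∈ m) :
    -(σ (σ w) * Φ v 1 + σ w * Φ v 2) * x + σ (σ w) * σ x + σ w * σ (σ x) = 0 := by
  have h := hm.det_eq_zero Φ hvm hw hx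
  rw [Matrix.det_fin_three] at h
  simp [splashVec, conjVec, hv] at h
  linear_combination h

include hΦ

omit hσ in
theorem exists_of_mem_linesE {m : Submodule K (Fin 3 → K)} (hm : m ∈ linesE π₀ s D) :
    IsLine m ∧ m ∉ D ∧ (∃ w : K, w ≠ 0 ∧ w + σ w + σ (σ w) = 0 ∧ Φ.symm (splashVec σ w) ∈ m) ∧
      ∃ x : K, x ≠ 0 ∧ Φ.symm (conjVec σ x) ∈ m := by
  obtain ⟨hl, ⟨P, hPs, hP⟩, ⟨R, hRπ, hR⟩, hD⟩ := hm
  obtain ⟨v, hv, rfl⟩ := exists_mk_eq P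
  obtain ⟨r, hr, rfl⟩ := exists_mk_eq R
  rw [onLine_mk] at hP hR
  rw [hΦ.mem_subline] at hPs
  rw [hΦ.mem_subplane] at hRπ
  obtain ⟨e, w, hw, he⟩ := hPs
  obtain ⟨c, x, hc⟩ := hRπ
  have hv' : Φ v ≠ 0 := by simpa using hv
  have hr' : Φ r ≠ 0 := by simpa using hr
  have he0 : e ≠ 0 := by rintro rfl; simp [he] at hv'
  have hc0 : c ≠ 0 := by rintro rfl; simp [hc] at hr'
  refine ⟨hl, hD, ⟨w, ?_, hw, ?_⟩, x, ?_, ?_⟩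
  · rintro rfl
    apply hv'
    rw [he]
    ext i
    fin_cases i <;> simp [splashVec]
  · rw [← m.smul_mem_iff he0, ← map_smul, ← he, LinearEquiv.symm_apply_apply]
    exact hP
  · rintro rfl
    apply hr'
    rw [hc]
    ext i
    fin_cases i <;> simp [conjVec]
  · rw [← m.smul_mem_iff hc0, ← map_smul, ← hc, LinearEquiv.symm_apply_apply]
    exact hR

omit hσ in
theorem mem_linesE {v : Fin 3 → K} (hv : Φ v 0 = 1) {w x : K} (hw : w ≠ 0)
    (htw : w + σ w + σ (σ w) = 0) (hx : x ≠ 0)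
    (h : -(σ (σ w) * Φ v 1 + σ w * Φ v 2) * x + σ (σ w) * σ x + σ w * σ (σ x) = 0)
    (hD : Submodule.span K {v, Φ.symm (splashVec σ w)} ∉ D) :
    Submodule.span K {v, Φ.symm (splashVec σ w)} ∈ linesE π₀ s D := by
  have hw1 : σ w ≠ 0 := (map_ne_zero σ).mpr hw
  have hsv : Φ.symm (splashVec σ w) ≠ 0 := by
    simpa using splashVec_ne_zero hw
  have hcv : Φ.symm (conjVec σ x) ≠ 0 := by
    simp only [ne_eq, EmbeddingLike.map_eq_zero_iff]
    intro h0
    exact hx (congrFun h0 0)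
  refine ⟨isLine_span_pair (linearIndependent_splash hv hw), ⟨Projectivization.mk K _ hsv, ?_, ?_⟩,
    ⟨Projectivization.mk K _ hcv, ?_, ?_⟩, hD⟩
  · exact (hΦ.mem_subline _ _).mpr ⟨1, w, htw, by simp⟩
  · rw [onLine_mk]
    exact Submodule.subset_span (by simp)
  · exact (hΦ.mem_subplane _ _).mpr ⟨1, x, by simp⟩
  · rw [onLine_mk, Submodule.mem_span_pair]
    -- The first two coordinates force these coefficients; the third is then the hypothesis `h`.
    refine ⟨x, (σ x - x * Φ v 1) / σ w, Φ.injective ?_⟩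
    rw [map_add, map_smul, map_smul, LinearEquiv.apply_symm_apply, LinearEquiv.apply_symm_apply]
    ext i
    fin_cases i
    · simp [splashVec, conjVec, hv]
    · simp [splashVec, conjVec, hw1]
    · simp [splashVec, conjVec]
      field_simp
      linear_combination -h

omit hΦ in
theorem span_eq_span_iff {v : Fin 3 → K} (hv : Φ v 0 = 1) {w₁ w₂ : K} (hw₁ : w₁ ≠ 0)
    (hw₂ : w₂ ≠ 0) :
    Submodule.span K {v, Φ.symm (splashVec σ w₁)} = Submodule.span K {v, Φ.symm (splashVec σ w₂)} ↔
      ∃ c : F, w₁ = algebraMap F K c * w₂ := by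
  constructor
  · intro h
    have h2 : Φ.symm (splashVec σ w₁) ∈ Submodule.span K {v, Φ.symm (splashVec σ w₂)} := by
      rw [← h]
      exact Submodule.subset_span (by simp)
    obtain ⟨x, y, hxy⟩ := Submodule.mem_span_pair.mp h2
    have h' := congrArg Φ hxy
    rw [map_add, map_smul, map_smul, LinearEquiv.apply_symm_apply,
      LinearEquiv.apply_symm_apply] at h'
    have h0 : x = 0 := by simpa [splashVec, hv] using congrFun h' 0
    rw [h0, zero_smul, zero_add] at h'
    have h1 : y * σ w₂ = σ w₁ := by simpa [splashVec] using congrFun h' 1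
    have h3 : y * σ (σ w₂) = σ (σ w₁) := by simpa [splashVec] using congrFun h' 2
    apply hσ.exists_algebraMap_mul_eq hw₂
    have h4 : σ (σ w₁ * w₂) = σ (w₁ * σ w₂) := by
      rw [map_mul, map_mul, ← h3, ← h1]
      ring
    exact σ.injective h4
  · rintro ⟨c, rfl⟩
    refine (isLine_span_pair (linearIndependent_splash hv hw₁)).eq_span_pair
      (Submodule.subset_span (by simp)) ?_ (linearIndependent_splash hv hw₂)
    have hc : algebraMap F K c ≠ 0 := left_ne_zero_of_mul hw₁
    rw [← Submodule.smul_mem_iff _ hc, ← map_smul]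
    apply Submodule.subset_span
    right
    rw [Set.mem_singleton_iff]
    congr 1
    ext i
    fin_cases i <;> simp [splashVec]

/-- A line of `E` through the point is recovered from the ratio σw/w, since equal ratios mean that
the w are F-proportional. These ratios are roots of a nonzero cubic. -/
theorem numThrough_le_three {v : Fin 3 → K} (hv0 : v ≠ 0) (hv : Φ v 0 = 1)
    (hp : joinCubic σ (Φ v 1) (Φ v 2) ≠ 0) :
    numThrough (linesE π₀ s D) (Projectivization.mk K v hv0) ≤ 3 := by
  have hex : ∀ m, m ∈ {m | m ∈ linesE π₀ s D ∧ OnLine (Projectivization.mk K v hv0) m} →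
      ∃ w : K, w ≠ 0 ∧ m = Submodule.span K {v, Φ.symm (splashVec σ w)} ∧
        (joinCubic σ (Φ v 1) (Φ v 2)).IsRoot (σ w / w) := by
    rintro m ⟨hm, hvm⟩
    rw [onLine_mk] at hvm
    obtain ⟨hml, -, ⟨w, hw, htw, hwm⟩, x, hx, hxm⟩ := exists_of_mem_linesE hΦ hm
    exact ⟨w, hw, hml.eq_span_pair hvm hwm (linearIndependent_splash hv hw),
      hσ.isRoot_joinCubic hw htw hx (join_eq_zero hml hv hvm hwm hxm)⟩
  choose! w hw hm hr using hex
  classical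
  refine (Set.ncard_le_ncard_of_injOn (t := (joinCubic σ (Φ v 1) (Φ v 2)).roots.toFinset)
    (fun m ↦ σ (w m) / w m) (fun m hmE ↦ ?_) (fun m₁ h₁ m₂ h₂ h ↦ ?_)
    (Finset.finite_toSet _)).trans ?_
  · simpa [hp] using hr m hmE
  · rw [hm m₁ h₁, hm m₂ h₂, hσ.span_eq_span_iff hv (hw m₁ h₁) (hw m₂ h₂)]
    apply hσ.exists_algebraMap_mul_eq (hw m₂ h₂)
    have := (div_eq_div_iff (hw m₁ h₁) (hw m₂ h₂)).mp h
    linear_combination this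
  · rw [Set.ncard_coe_finset]
    exact (Multiset.toFinset_card_le _).trans
      ((Polynomial.card_roots' _).trans (natDegree_joinCubic_le _ _ _))

omit hσ in
-- A line of `E` through such a point contains a second point of `l`, namely one of `s`. It is
-- therefore `l`, which misses `π₀`.
theorem numThrough_of_onLine (hl : IsLine l) (hdisj : ∀ P ∈ π₀, ¬ OnLine P l) {P : Point K}
    (hP : OnLine P l) (hPs : P ∉ s) : numThrough (linesE π₀ s D) P = 0 := by
  obtain ⟨v, hv, rfl⟩ := exists_mk_eq P
  rw [numThrough]
  suffices h : {m | m ∈ linesE π₀ s D ∧ OnLine (Projectivization.mk K v hv) m} = ∅ by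
    rw [h, Set.ncard_empty]
  rw [Set.eq_empty_iff_forall_notMem]
  rintro m ⟨hm, hvm⟩
  rw [onLine_mk] at hvm hP
  obtain ⟨hml, -, ⟨w, hw, htw, hwm⟩, -⟩ := exists_of_mem_linesE hΦ hm
  have hind : LinearIndependent K ![v, Φ.symm (splashVec σ w)] := by
    rw [LinearIndependent.pair_iff]
    intro x y h
    have hx : x = 0 := by
      by_contra hx
      apply hPs
      rw [hΦ.mem_subline]
      refine ⟨-(x⁻¹ * y), w, htw, ?_⟩
      have h' := congrArg Φ (eq_neg_of_add_eq_zero_left h)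
      rw [map_neg, map_smul, map_smul, LinearEquiv.apply_symm_apply] at h'
      rw [neg_smul, mul_smul, ← smul_neg, ← h', inv_smul_smul₀ hx]
    rw [hx, zero_smul, zero_add, smul_eq_zero] at h
    exact ⟨hx, h.resolve_right (by simpa using splashVec_ne_zero hw)⟩
  have hwl : Φ.symm (splashVec σ w) ∈ l := by
    rw [hΦ.mem_line]
    simp [splashVec]
  have := (hml.eq_span_pair hvm hwm hind).trans (hl.eq_span_pair hP hwl hind).symm
  obtain ⟨-, -, ⟨R, hR, hRm⟩, -⟩ := hm
  exact hdisj R hR (this ▸ hRm)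

end Normalized

end IsCubicFrobenius

namespace IsCubicFrobenius

variable {σ : K →ₐ[F] K} (hσ : IsCubicFrobenius σ)
  {π₀ : Set (Point K)} {l : Submodule K (Fin 3 → K)} {s : Set (Point K)}
  {D : Set (Submodule K (Fin 3 → K))} {Φ : (Fin 3 → K) ≃ₗ[K] (Fin 3 → K)}
  (hΦ : IsNormalizedFrame σ π₀ l s D Φ)
include hσ hΦ

theorem not_mem_subplane_of_exceptional {v : Fin 3 → K} (hv : v ≠ 0) {c k : K} (hk : k ≠ 0)
    (htk : k + σ k + σ (σ k) = 1) (h : Φ v = c • exceptionalVec σ k) :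
    Projectivization.mk K v hv ∉ π₀ := by
  rw [hΦ.mem_subplane]
  rintro ⟨e, x, he⟩
  have hv' : Φ v ≠ 0 := by simpa using hv
  have hc : c ≠ 0 := by rintro rfl; simp [h] at hv'
  have hx : x ≠ 0 := by
    rintro rfl
    apply hv'
    rw [he]
    ext i
    fin_cases i <;> simp [conjVec]
  -- A point x of the subplane lies on the line with coefficients the conjugates of w/x whenever tr
  -- w = 0, whereas an exceptional point lies on no such line.
  obtain ⟨w, hw, htw⟩ := hσ.exists_trace_eq_zero
  rw [hσ.trace_eq_zero_iff] at htw
  have h1 : conjForm σ (w / x) (Φ v) = 0 := by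
    have hx1 : σ x ≠ 0 := (map_ne_zero σ).mpr hx
    have hx2 : σ (σ x) ≠ 0 := (map_ne_zero σ).mpr hx1
    rw [he]
    simp only [conjForm, conjVec, Pi.smul_apply, smul_eq_mul, Matrix.cons_val, map_div₀]
    field_simp
    linear_combination e * htw
  have h2 : conjForm σ (w / x) (exceptionalVec σ k) = 0 := by
    apply mul_left_cancel₀ hc
    rw [mul_zero, ← h1, h]
    simp only [conjForm, Pi.smul_apply, smul_eq_mul]
    ring
  exact div_ne_zero hw hx (hσ.eq_zero_of_conjForm_exceptionalVec hk htk h2)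

theorem numThrough_exceptional [Finite F] {v : Fin 3 → K} (hv0 : v ≠ 0) (hv : Φ v 0 = 1) {k : K}
    (hk : k ≠ 0) (htk : k + σ k + σ (σ k) = 1)
    (hY : Φ v 1 * k ^ 2 = -(σ k * (k + σ (σ k))))
    (hZ : Φ v 2 * k ^ 2 = -(σ (σ k) * (k + σ k))) :
    numThrough (linesE π₀ s D) (Projectivization.mk K v hv0) = Nat.card F + 1 := by
  -- The points of `s` correspond to the projective line over F of the trace-zero plane, hence the
  -- count q + 1.
  let f : ℙ F (LinearMap.ker (Algebra.trace F K)) → Submodule K (Fin 3 → K) := fun p ↦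
    Submodule.span K {v, Φ.symm (splashVec σ (p.rep : K))}
  have hrep : ∀ p : ℙ F (LinearMap.ker (Algebra.trace F K)), (p.rep : K) ≠ 0 := fun p h ↦
    p.rep_nonzero (Subtype.ext h)
  have hf : Function.Injective f := by
    intro p p' h
    obtain ⟨c, hc⟩ := (hσ.span_eq_span_iff hv (hrep p) (hrep p')).mp h
    rw [← p.mk_rep, ← p'.mk_rep, Projectivization.mk_eq_mk_iff']
    exact ⟨c, Subtype.ext (by rw [hc, Submodule.coe_smul, Algebra.smul_def])⟩
  rw [← Projectivization.card_of_finrank_two F _ hσ.finrank_ker_trace,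
    ← Set.ncard_range_of_injective hf, numThrough]
  congr 1
  ext m
  constructor
  · rintro ⟨hm, hvm⟩
    rw [onLine_mk] at hvm
    obtain ⟨hml, -, ⟨w, hw, htw, hwm⟩, -⟩ := exists_of_mem_linesE hΦ hm
    have hw' : (⟨w, hσ.trace_eq_zero_iff.mpr htw⟩ : LinearMap.ker (Algebra.trace F K)) ≠ 0 :=
      fun h ↦ hw (congrArg Subtype.val h)
    refine ⟨Projectivization.mk F _ hw', ?_⟩
    rw [hml.eq_span_pair hvm hwm (linearIndependent_splash hv hw)]
    refine (hσ.span_eq_span_iff hv (hrep _) hw).mpr ?_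
    obtain ⟨a, ha⟩ := Projectivization.exists_smul_eq_mk_rep F _ hw'
    refine ⟨a, ?_⟩
    rw [← ha, Units.smul_def, Submodule.coe_smul, Algebra.smul_def]
  · rintro ⟨p, rfl⟩
    have hw := hrep p
    have htw := hσ.trace_eq_zero_iff.mp p.rep.2
    have hv_mem : v ∈ f p := Submodule.subset_span (by simp)
    have hk2 : k ^ 2 ≠ 0 := pow_ne_zero 2 hk
    have hΦv : Φ v = (k ^ 2)⁻¹ • exceptionalVec σ k := by
      rw [eq_inv_smul_iff₀ hk2]
      ext i
      fin_cases i
      · simp [exceptionalVec, hv]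
      · simp only [Fin.mk_one, Pi.smul_apply, smul_eq_mul, exceptionalVec, Matrix.cons_val]
        rw [← hY, mul_comm]
      · simp only [Fin.reduceFinMk, Pi.smul_apply, smul_eq_mul, exceptionalVec, Matrix.cons_val]
        rw [← hZ, mul_comm]
    refine ⟨mem_linesE hΦ hv hw htw
      (x := k ^ 2 * (σ p.rep * σ (σ k) - σ (σ p.rep) * σ k)) ?_ ?_ ?_, ?_⟩
    -- If x were 0, w would be an F-multiple of k, impossible as tr w = 0, w ≠ 0 and tr k = 1.
    · intro h
      have h0 := sub_eq_zero.mp ((mul_eq_zero.mp h).resolve_left hk2)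
      obtain ⟨c, hc⟩ := hσ.exists_algebraMap_mul_eq hk (y := (p.rep : K))
        (σ.injective ((map_mul σ _ _).trans (h0.symm.trans (map_mul σ _ _).symm)))
      rw [hc] at htw
      simp only [map_mul, AlgHom.commutes] at htw
      have : algebraMap F K c = 0 := by linear_combination htw - algebraMap F K c * htk
      exact hw (by rw [hc, this, zero_mul])
    · apply mul_left_cancel₀ hk2
      have hj := hσ.join_exceptional (k := k) htw
      linear_combination hj - (k ^ 2 * (σ p.rep * σ (σ k) - σ (σ p.rep) * σ k)) *
        (σ (σ p.rep) * hY + σ p.rep * hZ)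
    · intro hD
      obtain ⟨a, ha, haD⟩ := hΦ.conjForm_eq_zero _ hD
      have h1 := haD v hv_mem
      rw [hΦv] at h1
      apply ha
      apply hσ.eq_zero_of_conjForm_exceptionalVec hk htk
      apply mul_left_cancel₀ (inv_ne_zero hk2)
      rw [mul_zero, ← h1]
      simp only [conjForm, Pi.smul_apply, smul_eq_mul]
      ring
    · rwa [onLine_mk]

theorem numThrough_le_three_or_exceptional [Finite F] (hl : IsLine l)
    (hdisj : ∀ P ∈ π₀, ¬ OnLine P l) {P : Point K} (hP : P ∉ π₀ ∪ s) :
    numThrough (linesE π₀ s D) P ≤ 3 ∨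
      (numThrough (linesE π₀ s D) P = Nat.card F + 1 ∧ ∃ k, k + σ k + σ (σ k) = 1 ∧
        ∃ h : Φ.symm (exceptionalVec σ k) ≠ 0, Projectivization.mk K _ h = P) := by
  rw [Set.mem_union, not_or] at hP
  by_cases hPl : OnLine P l
  · left
    rw [numThrough_of_onLine hΦ hl hdisj hPl hP.2]
    omega
  obtain ⟨v, hv0, rfl, hv⟩ := exists_mk_eq_of_not_onLine hΦ.toIsSplashFrame hPl
  by_cases hp : joinCubic σ (Φ v 1) (Φ v 2) = 0
  · right
    rcases hσ.of_joinCubic_eq_zero hp with ⟨x, hx, h1, h2⟩ | ⟨k, hk, htk, hY, hZ⟩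
    · exfalso
      apply hP.1
      rw [hΦ.mem_subplane]
      refine ⟨x⁻¹, x, ?_⟩
      rw [eq_inv_smul_iff₀ hx]
      ext i
      fin_cases i
      · simp [conjVec, hv]
      · simp [conjVec, h1, mul_comm]
      · simp [conjVec, h2, mul_comm]
    · refine ⟨hσ.numThrough_exceptional hΦ hv0 hv hk htk hY hZ, k, htk, ?_⟩
      have h : Φ.symm (exceptionalVec σ k) = k ^ 2 • v := by
        apply Φ.injective
        rw [LinearEquiv.apply_symm_apply, map_smul]
        ext i
        fin_cases i
        · simp [exceptionalVec, hv]
        · simp only [Fin.mk_one, Pi.smul_apply, smul_eq_mul, exceptionalVec, Matrix.cons_val]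
          rw [← hY, mul_comm]
        · simp only [Fin.reduceFinMk, Pi.smul_apply, smul_eq_mul, exceptionalVec, Matrix.cons_val]
          rw [← hZ, mul_comm]
      refine ⟨h ▸ smul_ne_zero (pow_ne_zero 2 hk) hv0, ?_⟩
      rw [Projectivization.mk_eq_mk_iff']
      exact ⟨_, h.symm⟩
  · exact Or.inl (hσ.numThrough_le_three hΦ hv0 hv hp)

omit hσ hΦ in
theorem ne_zero_of_sum_eq_one {k : K} (hk : k + σ k + σ (σ k) = 1) : k ≠ 0 := by
  rintro rfl
  simp at hk

omit hσ hΦ in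
theorem symm_exceptionalVec_ne_zero (Φ : (Fin 3 → K) ≃ₗ[K] (Fin 3 → K)) {k : K} (hk : k ≠ 0) :
    Φ.symm (exceptionalVec σ k) ≠ 0 := by
  simp only [ne_eq, EmbeddingLike.map_eq_zero_iff]
  intro h
  exact pow_ne_zero 2 hk (congrFun h 0)

omit hΦ in
theorem mk_exceptional_injective {k j : K} (hk : k + σ k + σ (σ k) = 1)
    (hj : j + σ j + σ (σ j) = 1) (h₁ : Φ.symm (exceptionalVec σ k) ≠ 0)
    (h₂ : Φ.symm (exceptionalVec σ j) ≠ 0)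
    (h : Projectivization.mk K _ h₁ = Projectivization.mk K _ h₂) : k = j := by
  have hk0 := ne_zero_of_sum_eq_one hk
  have hj0 := ne_zero_of_sum_eq_one hj
  obtain ⟨c, hc⟩ := (Projectivization.mk_eq_mk_iff' _ _ _ _ _).mp h
  rw [← map_smul] at hc
  replace hc := Φ.symm.injective hc
  have e0 : c * j ^ 2 = k ^ 2 := congrFun hc 0
  have e1 : c * -(σ j * (j + σ (σ j))) = -(σ k * (k + σ (σ k))) := congrFun hc 1
  have e2 : c * -(σ (σ j) * (j + σ j)) = -(σ (σ k) * (k + σ k)) := congrFun hc 2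
  have hj2 := pow_ne_zero 2 hj0
  refine hσ.exceptional_injective (Y := -(σ j * (j + σ (σ j))) / j ^ 2)
    (Z := -(σ (σ j) * (j + σ j)) / j ^ 2) hk0 hk ?_ ?_ hj0 hj
    (div_mul_cancel₀ _ hj2) (div_mul_cancel₀ _ hj2)
  · rw [← e1, ← e0]; field_simp
  · rw [← e2, ← e0]; field_simp

theorem exceptional_properties [Finite F] (hsl : ∀ P ∈ s, OnLine P l) {k : K}
    (htk : k + σ k + σ (σ k) = 1) (h : Φ.symm (exceptionalVec σ k) ≠ 0) :
    Projectivization.mk K _ h ∉ π₀ ∪ s ∧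
      numThrough (linesE π₀ s D) (Projectivization.mk K _ h) = Nat.card F + 1 ∧
      Projectivization.mk K _ h ∈ O₃ F π₀ := by
  have hk := ne_zero_of_sum_eq_one htk
  have hk2 := pow_ne_zero 2 hk
  have hπ : Projectivization.mk K _ h ∉ π₀ :=
    hσ.not_mem_subplane_of_exceptional hΦ h hk htk (c := 1) (by simp)
  have hl : ¬ OnLine (Projectivization.mk K _ h) l := by
    rw [onLine_mk, hΦ.mem_line]
    simp [exceptionalVec, hk]
  refine ⟨?_, ?_, ?_⟩
  · rintro (h1 | h1)
    · exact hπ h1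
    · exact hl (hsl _ h1)
  · have hv0 : (k ^ 2)⁻¹ • Φ.symm (exceptionalVec σ k) ≠ 0 := smul_ne_zero (inv_ne_zero hk2) h
    have e : Projectivization.mk K _ h = Projectivization.mk K _ hv0 :=
      ((Projectivization.mk_eq_mk_iff' _ _ _ _ _).mpr ⟨_, rfl⟩).symm
    rw [e]
    refine hσ.numThrough_exceptional hΦ hv0 ?_ hk htk ?_ ?_
    · simp [exceptionalVec, hk]
    · simp only [map_smul, LinearEquiv.apply_symm_apply, exceptionalVec, Pi.smul_apply,
        Matrix.cons_val, smul_eq_mul]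
      field_simp
    · simp only [map_smul, LinearEquiv.apply_symm_apply, exceptionalVec, Pi.smul_apply,
        Matrix.cons_val, smul_eq_mul]
      field_simp
  · rintro (h1 | ⟨m, ⟨hm, hvm⟩, -⟩)
    · exact hπ h1
    · obtain ⟨a, ha, ham⟩ := hσ.conjForm_eq_zero_of_mem_extendedSublines hΦ.toIsSplashFrame hm
      rw [onLine_mk] at hvm
      have := ham _ hvm
      rw [LinearEquiv.apply_symm_apply] at this
      exact ha (hσ.eq_zero_of_conjForm_exceptionalVec hk htk this)

end IsCubicFrobenius

end SplashPlane

/-! ### Conclusion -/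

theorem mainTheorem4 {F K : Type*} [Field F] [Field K] [Algebra F K] (q : ℕ) (hq : 2 < q)
    (hF : Nat.card F = q) (hK : Nat.card K = q ^ 3)
    (π₀ : Set (SplashPlane.Point K)) (hπ₀ : SplashPlane.IsSubplane F π₀)
    (l : Submodule K (Fin 3 → K)) (hl : SplashPlane.IsLine l)
    (hdisj : ∀ P ∈ π₀, ¬ SplashPlane.OnLine P l)
    (s : Set (SplashPlane.Point K)) (hs : SplashPlane.IsSubline F l s)
    (hsS : s ⊆ SplashPlane.splash F π₀ l)
    (D : Set (Submodule K (Fin 3 → K))) (hD : SplashPlane.IsDualSubconic F π₀ D)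
    (hsD : s = SplashPlane.trace D l) :
    (∀ P : SplashPlane.Point K, P ∉ π₀ ∪ s →
      SplashPlane.numThrough (SplashPlane.linesE π₀ s D) P ∈ ({0, 1, 2, 3, q + 1} : Set ℕ)) ∧
    {P : SplashPlane.Point K | P ∉ π₀ ∪ s ∧
      SplashPlane.numThrough (SplashPlane.linesE π₀ s D) P = q + 1}.ncard = q ^ 2 ∧
    {P : SplashPlane.Point K | P ∉ π₀ ∪ s ∧
      SplashPlane.numThrough (SplashPlane.linesE π₀ s D) P = q + 1} ⊆ SplashPlane.O₃ F π₀ := by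
  subst hF
  have : Finite F := Nat.finite_of_card_ne_zero (by omega)
  have : Finite K := Nat.finite_of_card_ne_zero (by rw [hK]; exact pow_ne_zero 3 (by omega))
  obtain ⟨σ, hσ⟩ := SplashPlane.exists_isCubicFrobenius hK
  have hr : ∃ r : F, r ≠ 0 ∧ r ≠ 1 := by
    by_contra! h
    have h2 : (Set.univ : Set F) ⊆ {0, 1} := fun r _ ↦ by
      by_cases h0 : r = 0
      · exact Or.inl h0
      · exact Or.inr (h r h0)
    have h3 := (Set.ncard_le_ncard h2).trans (Set.ncard_insert_le _ _)
    rw [Set.ncard_univ, Set.ncard_singleton] at h3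
    omega
  obtain ⟨Φ, hframe, hsub, hDl⟩ := hσ.exists_normalized_frame hr hl hdisj hs hD hsD
  have hΦ : SplashPlane.IsNormalizedFrame σ π₀ l s D Φ := ⟨hframe, hsub, hDl⟩
  have hsl : ∀ P ∈ s, SplashPlane.OnLine P l := fun P hP ↦ (hsS hP).1
  have hmain := fun P hP ↦ hσ.numThrough_le_three_or_exceptional hΦ hl hdisj (P := P) hP
  have hexc : ∀ P : SplashPlane.Point K, P ∉ π₀ ∪ s →
      SplashPlane.numThrough (SplashPlane.linesE π₀ s D) P = Nat.card F + 1 →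
      ∃ k, k + σ k + σ (σ k) = 1 ∧ ∃ h : Φ.symm (SplashPlane.exceptionalVec σ k) ≠ 0,
        Projectivization.mk K _ h = P := by
    intro P hP hn
    rcases hmain P hP with h | ⟨-, h⟩
    -- Since q > 2, the value q + 1 exceeds 3, so the first alternative is excluded.
    · omega
    · exact h
  refine ⟨fun P hP ↦ ?_, ?_, ?_⟩
  · rcases hmain P hP with h | ⟨h, -⟩
    · simp only [Set.mem_insert_iff, Set.mem_singleton_iff]
      omega
    · simp [h]
  · rw [← hσ.ncard_trace_eq_one]
    refine (Set.ncard_congr (fun k hk ↦ Projectivization.mk K _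
      (SplashPlane.IsCubicFrobenius.symm_exceptionalVec_ne_zero Φ
        (SplashPlane.IsCubicFrobenius.ne_zero_of_sum_eq_one hk))) (fun k hk ↦ ?_)
      (fun k j hk hj h ↦ hσ.mk_exceptional_injective hk hj _ _ h) ?_).symm
    · obtain ⟨h1, h2, -⟩ := hσ.exceptional_properties hΦ hsl hk
        (SplashPlane.IsCubicFrobenius.symm_exceptionalVec_ne_zero Φ
          (SplashPlane.IsCubicFrobenius.ne_zero_of_sum_eq_one hk))
      exact ⟨h1, h2⟩
    · rintro P ⟨hP, hn⟩
      obtain ⟨k, hk, h, rfl⟩ := hexc P hP hn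
      exact ⟨k, hk, rfl⟩
  · rintro P ⟨hP, hn⟩
    obtain ⟨k, hk, h, rfl⟩ := hexc P hP hn
    exact (hσ.exceptional_properties hΦ hsl hk h).2.2
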